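/- Let $(\Omega,\mathscr{F},\mathbb{P})$ be a probability space with a discrete filtration $(\mathscr{F}_t)_{t=0,\ldots,T}$, $T\in\mathbb{N}_0$, such that $\mathscr{F}_0$ is $\mathbb{P}$-trivial (every set in $\mathscr{F}_0$ has probability $0$ or $1$; for example $\mathscr{F}_0=\{\emptyset,\Omega\}$). (In)equalities between random variables are understood $\mathbb{P}$-almost surely. A real-valued process $X=(X_t)_{t=0,\ldots,T}$ is predictable if $X_0$ is $\mathscr{F}_0$-measurable and $X_t$ is $\mathscr{F}_{t-1}$-measurable for $t=1,\ldots,T$. Let $\mathbb{S}=\{S^1,\ldots,S^d\}$ be a finite market of nonnegative adapted real-valued processes, and let $B$ be a savings account, that is, a predictable process with $B_0=1$ and $B_t>0$ for all $t$. A self-financing strategy for the market $\mathbb{S}\cup\{B\}$ is a family $(\delta^1,\ldots,\delta^d,\eta)$ of real-valued predictable processes whose portfolio $V_t=\sum_{i=1}^d\delta^i_tS^i_t+\eta_tB_t$ satisfies $$V_t=V_0+\sum_{k=1}^t\Big(\sum_{i=1}^d\delta^i_k(S^i_k-S^i_{k-1})+\eta_k(B_k-B_{k-1})\Big),\qquad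 t=0,\ldots,T.$$ Let $\mathscr{P}_{\mathrm{sf},0}(\mathbb{S}\cup\{B\})\subset L^0(\Omega,\mathscr{F}_T,\mathbb{P})$ be the set of terminal values $V_T$ of all such portfolios with $V_0=0$. It satisfies NA (No Arbitrage) if $\mathscr{P}_{\mathrm{sf},0}(\mathbb{S}\cup\{B\})\cap L^0_+=\{0\}$, where $L^0_+$ is the set of nonnegative elements of $L^0(\Omega,\mathscr{F}_T,\mathbb{P})$. Then the following statements are equivalent: (i) $\mathscr{P}_{\mathrm{sf},0}(\mathbb{S}\cup\{B\})$ satisfies NA. (ii) There exists a $\mathbb{P}$-martingale $D>0$ such that $Z=DB^{-1}$ is an equivalent martingale deflator (EMD) for $\mathbb{S}$, that is, $Z$ is adapted, $Z>0$, and $S^iZ$ is a $\mathbb{P}$-martingale for every $i=1,\ldots,d$. (iii) There exists an equivalent martingale measure (EMM) for $\mathbb{S}B^{-1}$, that is, a probability measure $\mathbb{Q}$ on $(\Omega,\mathscr{F}_T)$ which is equivalent to $\mathbb{P}|_{\mathscr{F}_T}$ and under which $S^iB^{-1}$ is a martingale for every $i=1,\ldots,d$. -/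

import Mathlib

open MeasureTheory

namespace DiscreteMarket

noncomputable section

/-- In discrete time `0, …, T`, predictability with respect to the predictable σ-algebra means that
the initial value is known at time `0` and that the value at time `k + 1` is known at time `k`. -/
theorem isStronglyPredictable_iff {Ω : Type*} {m : MeasurableSpace Ω} {T : ℕ}
    (ℱ : Filtration (Fin (T + 1)) m) (u : Fin (T + 1) → Ω → ℝ) :
    IsStronglyPredictable ℱ u ↔
      Measurable[ℱ 0] (u 0) ∧ ∀ k : Fin T, Measurable[ℱ k.castSucc] (u k.succ) := by
  have hbot : (⊥ : Fin (T + 1)) = 0 := rfl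
  constructor
  · intro h
    have hu : Measurable[ℱ.predictable] (Function.uncurry u) := h.measurable
    constructor
    · have : @Measurable _ _ (ℱ 0) ℱ.predictable (fun ω : Ω => ((0 : Fin (T + 1)), ω)) := by
        refine @measurable_generateFrom _ _ (ℱ 0) _ _ ?_
        rintro _ (⟨A, hA, rfl⟩ | ⟨i, A, hA, rfl⟩)
        · have hpre : (fun ω : Ω => ((0 : Fin (T + 1)), ω)) ⁻¹' ({⊥} ×ˢ A) = A := by
            ext ω
            simp [hbot]
          rw [hpre]
          exact hA
        · convert (@MeasurableSet.empty _ (ℱ 0)) using 1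
          ext ω
          simp
      exact hu.comp this
    · intro k
      have : @Measurable _ _ (ℱ k.castSucc) ℱ.predictable (fun ω : Ω => (k.succ, ω)) := by
        refine @measurable_generateFrom _ _ (ℱ k.castSucc) _ _ ?_
        rintro _ (⟨A, hA, rfl⟩ | ⟨i, A, hA, rfl⟩)
        · convert (@MeasurableSet.empty _ (ℱ k.castSucc)) using 1
          ext ω
          simp [hbot, Fin.succ_ne_zero]
        · by_cases hi : i < k.succ
          · convert ℱ.mono (Fin.le_castSucc_iff.mpr hi) A hA using 1
            ext ω
            simp [hi]
          · convert (@MeasurableSet.empty _ (ℱ k.castSucc)) using 1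
            ext ω
            simp only [Set.mem_preimage, Set.mem_prod, Set.mem_Ioi, Set.mem_empty_iff_false]
            tauto
      exact hu.comp this
  · rintro ⟨h0, h1⟩
    have key : Measurable[ℱ.predictable] (Function.uncurry u) := by
      intro s hs
      have : Function.uncurry u ⁻¹' s = ⋃ t : Fin (T + 1), {t} ×ˢ (u t ⁻¹' s) := by
        ext ⟨t, ω⟩
        simp [Function.uncurry]
      rw [this]
      refine @MeasurableSet.iUnion _ _ ℱ.predictable _ _ fun t => ?_
      refine Fin.cases ?_ (fun k => ?_) t
      · exact measurableSet_predictable_singleton_bot_prod (h0 hs)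
      · have he : ({k.succ} : Set (Fin (T + 1))) = Set.Ioc k.castSucc k.succ := by
          ext j
          simp only [Set.mem_singleton_iff, Set.mem_Ioc, Fin.ext_iff, Fin.lt_def, Fin.le_def,
            Fin.val_succ, Fin.val_castSucc]
          omega
        rw [he]
        exact measurableSet_predictable_Ioc_prod _ _ (h1 k hs)
    exact Measurable.stronglyMeasurable (mα := ℱ.predictable) key

variable {Ω : Type*} {m : MeasurableSpace Ω} {T : ℕ}

/-- A savings account: a predictable, strictly positive process with initial value `1`. (In discrete
time every process is càdlàg and of finite variation, and `B₋ > 0` follows from `B > 0`.) -/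
structure IsSavingsAccount (ℱ : Filtration (Fin (T + 1)) m) (P : Measure Ω)
    (B : Fin (T + 1) → Ω → ℝ) : Prop where
  predictable : IsStronglyPredictable ℱ B
  initial : ∀ᵐ ω ∂P, B 0 ω = 1
  pos : ∀ t, ∀ᵐ ω ∂P, 0 < B t ω

/-- The market `𝕊 ∪ {B}`; the security `B` has index `none`. -/
def adjoin {ι : Type*} (S : ι → Fin (T + 1) → Ω → ℝ) (B : Fin (T + 1) → Ω → ℝ) :
    Option ι → Fin (T + 1) → Ω → ℝ
  | none => B
  | some i => S i

/-- The market `𝕊 Y = {Sⁱ Y}`. -/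
def mulMarket {ι : Type*} (S : ι → Fin (T + 1) → Ω → ℝ) (Y : Fin (T + 1) → Ω → ℝ) :
    ι → Fin (T + 1) → Ω → ℝ :=
  fun i t ω => S i t ω * Y t ω

/-- A strategy: the numbers of units held form a predictable process. -/
def IsStrategy {ι : Type*} (ℱ : Filtration (Fin (T + 1)) m) (δ : ι → Fin (T + 1) → Ω → ℝ) : Prop :=
  ∀ i, IsStronglyPredictable ℱ (δ i)

/-- The portfolio `S^δ = δ · S`. -/
def portfolio {ι : Type*} [Fintype ι] (S δ : ι → Fin (T + 1) → Ω → ℝ) : Fin (T + 1) → Ω → ℝ :=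
  fun t ω => ∑ i, δ i t ω * S i t ω

/-- The stochastic integral of `δ` with respect to `S` at time `t`, which is
`∑_{k=1}^t δ_k · (S_k - S_{k-1})`. -/
def stochIntegral {ι : Type*} [Fintype ι] (δ S : ι → Fin (T + 1) → Ω → ℝ) :
    Fin (T + 1) → Ω → ℝ :=
  fun t ω => ∑ k : Fin T with k.succ ≤ t, ∑ i, δ i k.succ ω * (S i k.succ ω - S i k.castSucc ω)

/-- Self-financing strategies: `S^δ = S^δ_0 + ∫ δ dS`. -/
def IsSelfFinancing {ι : Type*} [Fintype ι] (ℱ : Filtration (Fin (T + 1)) m) (P : Measure Ω)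
    (S δ : ι → Fin (T + 1) → Ω → ℝ) : Prop :=
  IsStrategy ℱ δ ∧
    ∀ t, ∀ᵐ ω ∂P, portfolio S δ t ω = portfolio S δ 0 ω + stochIntegral δ S t ω

/-- The restriction of `P` to the σ-algebra `ℱ_T`. -/
abbrev terminalMeasure (ℱ : Filtration (Fin (T + 1)) m) (P : Measure Ω) :
    @Measure Ω (ℱ (Fin.last T)) :=
  P.trim (ℱ.le (Fin.last T))

/-- The space `L⁰(Ω, ℱ_T, P)` of classes of real-valued random variables. -/
abbrev L0 (ℱ : Filtration (Fin (T + 1)) m) (P : Measure Ω) :=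
  @AEEqFun Ω ℝ (ℱ (Fin.last T)) _ (terminalMeasure ℱ P)

/-- The set of terminal values of self-financing portfolios with initial value `α`. -/
def sfOutcomes {ι : Type*} [Fintype ι] (ℱ : Filtration (Fin (T + 1)) m) (P : Measure Ω)
    (S : ι → Fin (T + 1) → Ω → ℝ) (α : ℝ) : Set (L0 ℱ P) :=
  {ξ | ∃ δ : ι → Fin (T + 1) → Ω → ℝ, IsSelfFinancing ℱ P S δ ∧
    (∀ᵐ ω ∂P, portfolio S δ 0 ω = α) ∧ ∀ᵐ ω ∂P, ξ ω = portfolio S δ (Fin.last T) ω}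

/-- No Arbitrage for a set of outcomes `K`: `K ∩ L⁰₊ = {0}`. -/
def NA {ℱ : Filtration (Fin (T + 1)) m} {P : Measure Ω} (K : Set (L0 ℱ P)) : Prop :=
  K ∩ {ξ | 0 ≤ ξ} = {0}

/-- `Z` is an equivalent martingale deflator for the family `X`. (In discrete time a semimartingale
is just an adapted process, and `Z₋ > 0` follows from `Z > 0`.) -/
structure IsEMD {ι : Type*} (ℱ : Filtration (Fin (T + 1)) m) (P : Measure Ω)
    (X : ι → Fin (T + 1) → Ω → ℝ) (Z : Fin (T + 1) → Ω → ℝ) : Prop where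
  adapted : Adapted ℱ Z
  pos : ∀ t, ∀ᵐ ω ∂P, 0 < Z t ω
  martingale : ∀ i, Martingale (fun t ω => X i t ω * Z t ω) ℱ P

/-- The filtration `ℱ`, viewed on the measurable space `(Ω, ℱ_T)`. -/
def terminalFiltration (ℱ : Filtration (Fin (T + 1)) m) :
    Filtration (Fin (T + 1)) (ℱ (Fin.last T)) where
  seq := ℱ
  mono' := ℱ.mono'
  le' := fun t => ℱ.mono (Fin.le_last t)

/-- `Q` is an equivalent martingale measure for the family `X`: a probability measure on `(Ω, ℱ_T)`
which is equivalent to `P` on `ℱ_T` and under which every member of `X` is a martingale. -/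
structure IsEMM {ι : Type*} (ℱ : Filtration (Fin (T + 1)) m) (P : Measure Ω)
    (X : ι → Fin (T + 1) → Ω → ℝ) (Q : @Measure Ω (ℱ (Fin.last T))) : Prop where
  isProbabilityMeasure : IsProbabilityMeasure Q
  absolutelyContinuous : Q ≪ terminalMeasure ℱ P
  absolutelyContinuous' : terminalMeasure ℱ P ≪ Q
  martingale : ∀ i, Martingale (X i) (terminalFiltration ℱ) Q

end

end DiscreteMarket

/-!
The equivalence is the Dalang–Morton–Willinger theorem for prices discounted by `B`. The
implications (i) → (ii) → (iii) → (i) are shown, and no arbitrage is always compared with its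
single-period version `NoArbitrageStep`: a position taken at time `k` whose discounted gain over
the next period is nonnegative gains nothing. An arbitrage over one period extends to all times by
keeping the gain in the savings account (`NA.noArbitrageStep`). Conversely, if no single period
admits arbitrage, then a self-financing portfolio with nonnegative terminal value is nonnegative at
all earlier times, by backward induction, and if it starts at zero it stays at zero
(`NA_of_noArbitrageStep`).

The substantial step is the construction of a pricing density for a single period
(`NoArbitrageStep.exists_density`). Dividing by the size of the prices makes the increments
bounded, and a conditional Gram–Schmidt process makes them conditionally orthogonal
(`exists_condExp_orthogonal`), so that a position is recovered from its gain by conditional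
expectations. A convex compactness argument in `L²` shows that, for bounded positions, small losses
force small gains (`NoArbitrageStep.exists_integral_le`). Normalizing arbitrary positions and
applying this twofold information shows that no sequence of claims superhedged at zero cost can
tend to a nonzero nonnegative claim (`NoArbitrageStep.limit_nonpos`). Neither measurable selection
nor random subsequences are needed. The Hahn–Banach theorem in `L²` and an exhaustion argument
(`exists_mem_properCone_pos`, due to Kreps and Yan) then provide a strictly positive density.

The densities of the single periods are normalized and multiplied (`densityProcess`). As the prices
are nonnegative and the initial prices are constant, integrability of the deflated prices
propagates from each time to the next, so that they are martingales
(`martingale_mul_densityProcess`). This is (ii). The terminal value of the martingale `D` is the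
density of an equivalent martingale measure, up to normalization (`exists_isEMM_of_deflator`),
which is (iii). Under such a measure bounded positions have expected gain zero, hence no single
period admits arbitrage.
-/

namespace DiscreteMarket

open Filter Topology

open scoped ENNReal

section

/-! ### A compactness principle in Hilbert space -/

/-- The substitute for weak compactness: the points of minimal norm form a Cauchy sequence, by the
parallelogram identity. -/
theorem nonempty_iInter_of_antitone_convex {H : Type*} [NormedAddCommGroup H]
    [InnerProductSpace ℝ H] [CompleteSpace H] {C : ℕ → Set H} (hmono : Antitone C)
    (hclosed : ∀ n, IsClosed (C n)) (hconvex : ∀ n, Convex ℝ (C n)) (hne : ∀ n, (C n).Nonempty)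
    {R : ℝ} (hbdd : ∀ x ∈ C 0, ‖x‖ ≤ R) : (⋂ n, C n).Nonempty := by
  have hmin : ∀ n, ∃ v ∈ C n, ∀ w ∈ C n, ‖v‖ ≤ ‖w‖ := by
    intro n
    obtain ⟨v, hv, hvn⟩ := exists_norm_eq_iInf_of_complete_convex (hne n)
      (hclosed n).isComplete (hconvex n) 0
    refine ⟨v, hv, fun w hw => ?_⟩
    have : ‖(0 : H) - v‖ ≤ ‖(0 : H) - w‖ := by
      rw [hvn]
      exact ciInf_le ⟨0, Set.forall_mem_range.2 fun _ => norm_nonneg _⟩ (⟨w, hw⟩ : C n)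
    simpa using this
  choose v hv hvmin using hmin
  have hvmono : Monotone fun n => ‖v n‖ ^ 2 := fun a b hab =>
    pow_le_pow_left₀ (norm_nonneg _) (hvmin a _ (hmono hab (hv b))) 2
  have hvbdd : BddAbove (Set.range fun n => ‖v n‖ ^ 2) := by
    refine ⟨R ^ 2, ?_⟩
    rintro _ ⟨n, rfl⟩
    exact pow_le_pow_left₀ (norm_nonneg _) (hbdd _ (hmono (Nat.zero_le n) (hv n))) 2
  have hlim := tendsto_atTop_ciSup hvmono hvbdd
  set a := ⨆ n, ‖v n‖ ^ 2
  have hkey : ∀ n m, n ≤ m → ‖v m - v n‖ ^ 2 ≤ 2 * (a - ‖v n‖ ^ 2) := by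
    intro n m hnm
    have hmid : (1 / 2 : ℝ) • v m + (1 / 2 : ℝ) • v n ∈ C n :=
      hconvex n (hmono hnm (hv m)) (hv n) (by norm_num) (by norm_num) (by norm_num)
    have h1 := hvmin n _ hmid
    rw [← smul_add, norm_smul] at h1
    norm_num at h1
    have h2 := parallelogram_law_with_norm ℝ (v m) (v n)
    have h3 : ‖v m‖ ^ 2 ≤ a := le_ciSup hvbdd m
    nlinarith [norm_nonneg (v n), norm_nonneg (v m + v n)]
  have hcauchy : CauchySeq v := by
    refine Metric.cauchySeq_iff'.2 fun ε hε => ?_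
    have h0 : Tendsto (fun n => 2 * (a - ‖v n‖ ^ 2)) atTop (𝓝 0) := by
      simpa using (hlim.const_sub a).const_mul 2
    obtain ⟨N, hN⟩ := (h0.eventually (gt_mem_nhds (pow_pos hε 2))).exists
    refine ⟨N, fun n hn => ?_⟩
    rw [dist_eq_norm]
    exact lt_of_pow_lt_pow_left₀ 2 hε.le ((hkey N n hn).trans_lt hN)
  obtain ⟨x, hx⟩ := cauchySeq_tendsto_of_complete hcauchy
  refine ⟨x, Set.mem_iInter.2 fun n => ?_⟩
  refine (hclosed n).mem_of_tendsto hx ?_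
  filter_upwards [eventually_ge_atTop n] with k hk using hmono hk (hv k)

/-! ### Absence of arbitrage over a single period -/

/-- There is no arbitrage in a single period with price increments `X`: a position `θ`, known at the
beginning of the period (that is, `G`-measurable), whose gain `θ · X` is nonnegative gains
nothing. -/
def NoArbitrageStep {Ω ι : Type*} [Fintype ι] (G : MeasurableSpace Ω) {m0 : MeasurableSpace Ω}
    (μ : Measure Ω) (X : ι → Ω → ℝ) : Prop :=
  ∀ θ : ι → Ω → ℝ, (∀ i, Measurable[G] (θ i)) → (∀ᵐ ω ∂μ, 0 ≤ ∑ i, θ i ω * X i ω) →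
    ∀ᵐ ω ∂μ, ∑ i, θ i ω * X i ω = 0

variable {Ω ι : Type*} [Fintype ι] {G m0 : MeasurableSpace Ω} {μ : Measure Ω} [IsFiniteMeasure μ]

/-- Among positions bounded by `1`, a uniformly small expected loss forces a uniformly small
expected gain. The positions that violate this for smaller and smaller losses form decreasing
bounded closed convex subsets of `L²`; a common element would be an arbitrage. -/
theorem NoArbitrageStep.exists_integral_le (hG : G ≤ m0) {X : ι → Ω → ℝ}
    (hNA : NoArbitrageStep G μ X) (hXm : ∀ i, Measurable (X i)) {c : ℝ}
    (hXb : ∀ i ω, |X i ω| ≤ c) {ε : ℝ} (hε : 0 < ε) :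
    ∃ δ > 0, ∀ u : ι → Ω → ℝ, (∀ i, Measurable[G] (u i)) → (∀ i ω, |u i ω| ≤ 1) →
      ∫ ω, max (-∑ i, u i ω * X i ω) 0 ∂μ ≤ δ → ∫ ω, ∑ i, u i ω * X i ω ∂μ ≤ ε := by
  by_contra! hcon
  have hX : ∀ i, MemLp (X i) ∞ μ := fun i =>
    memLp_top_of_bound (hXm i).aestronglyMeasurable c (.of_forall (hXb i))
  let one : Lp ℝ 2 μ := indicatorConstLp 2 MeasurableSet.univ (measure_ne_top μ _) (1 : ℝ)
  have hone : ∀ᵐ ω ∂μ, one ω = 1 := by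
    filter_upwards [indicatorConstLp_coeFn (p := 2) (μ := μ) (hs := MeasurableSet.univ)
      (hμs := measure_ne_top μ _) (c := (1 : ℝ))] with ω hω
    exact hω.trans (Set.indicator_of_mem (Set.mem_univ ω) _)
  let ℓ : Lp ℝ 2 μ →L[ℝ] ℝ := innerSL ℝ one
  have hℓ : ∀ f : Lp ℝ 2 μ, ℓ f = ∫ ω, f ω ∂μ := by
    intro f
    have := L2.inner_indicatorConstLp_one (𝕜 := ℝ) MeasurableSet.univ (measure_ne_top μ _) f
    simpa [ℓ, one] using this
  have hℓmono : ∀ f g : Lp ℝ 2 μ, f ≤ g → ℓ f ≤ ℓ g := by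
    intro f g hfg
    rw [hℓ, hℓ]
    exact integral_mono_ae ((Lp.memLp f).integrable (by norm_num))
      ((Lp.memLp g).integrable (by norm_num)) ((Lp.coeFn_le f g).2 hfg)
  -- the gain of a position
  let Φ : PiLp 2 (fun _ : ι => Lp ℝ 2 μ) →L[ℝ] Lp ℝ 2 μ := ∑ i,
    ((ContinuousLinearMap.mul ℝ ℝ).holderL μ ∞ 2 2 ((hX i).toLp (X i))) ∘L
      (PiLp.proj 2 (fun _ : ι => Lp ℝ 2 μ) i)
  have hΦ : ∀ u, Φ u =ᵐ[μ] fun ω => ∑ i, u i ω * X i ω := by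
    intro u
    have h1 : Φ u = ∑ i, (ContinuousLinearMap.mul ℝ ℝ).holder 2 ((hX i).toLp (X i)) (u i) := by
      simp only [Φ, _root_.sum_apply]
      rfl
    have h2 : ∀ᵐ ω ∂μ, ∀ i, (ContinuousLinearMap.mul ℝ ℝ).holder 2 ((hX i).toLp (X i)) (u i) ω
        = u i ω * X i ω := by
      rw [ae_all_iff]
      intro i
      filter_upwards [(ContinuousLinearMap.mul ℝ ℝ).coeFn_holder (r := 2) ((hX i).toLp (X i)) (u i),
        (hX i).coeFn_toLp] with ω h h'
      rw [h, h']
      simp [mul_comm]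
    rw [h1]
    filter_upwards [Lp.coeFn_finsetSum Finset.univ (fun i =>
      (ContinuousLinearMap.mul ℝ ℝ).holder 2 ((hX i).toLp (X i)) (u i)), h2] with ω h3 h4
    rw [h3, Finset.sum_apply]
    exact Finset.sum_congr rfl fun i _ => h4 i
  -- the expected loss
  let N : PiLp 2 (fun _ : ι => Lp ℝ 2 μ) → ℝ := fun u => ℓ ((-Φ u) ⊔ 0)
  have hN : ∀ u, N u = ∫ ω, max (-∑ i, u i ω * X i ω) 0 ∂μ := by
    intro u
    simp only [N, hℓ]
    refine integral_congr_ae ?_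
    filter_upwards [Lp.coeFn_sup (-Φ u) 0, Lp.coeFn_neg (Φ u), Lp.coeFn_zero ℝ 2 μ, hΦ u]
      with ω h1 h2 h3 h4
    rw [h1, Pi.sup_apply, h2, h3, Pi.neg_apply, h4]
    rfl
  have hNcont : Continuous N := ℓ.continuous.comp (Φ.continuous.neg.sup continuous_const)
  -- positions bounded by `1` with expected loss at most `1 / (n + 1)` and expected gain
  -- at least `ε`
  let C : ℕ → Set (PiLp 2 (fun _ : ι => Lp ℝ 2 μ)) := fun n =>
    {u | (∀ i, u i ∈ lpMeas ℝ ℝ G 2 μ ∧ u i ∈ Set.Icc (-one) one) ∧ N u ≤ 1 / ((n : ℝ) + 1) ∧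
      ε ≤ ℓ (Φ u)}
  have hCmono : Antitone C := by
    intro a b hab u hu
    refine ⟨hu.1, hu.2.1.trans ?_, hu.2.2⟩
    exact one_div_le_one_div_of_le (by positivity) (by exact_mod_cast Nat.succ_le_succ hab)
  have hCclosed : ∀ n, IsClosed (C n) := by
    intro n
    refine IsClosed.inter ?_ (IsClosed.inter (isClosed_le hNcont continuous_const)
      (isClosed_le continuous_const (ℓ.continuous.comp Φ.continuous)))
    have : IsClosed (⋂ i, (fun u : PiLp 2 (fun _ : ι => Lp ℝ 2 μ) => u i) ⁻¹'
        ({f | AEStronglyMeasurable[G] f μ} ∩ Set.Icc (-one) one)) :=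
      isClosed_iInter fun i => ((isClosed_aestronglyMeasurable hG).inter isClosed_Icc).preimage
        (PiLp.continuous_apply 2 _ i)
    refine (congrArg IsClosed ?_).mp this
    ext u
    simp [mem_lpMeas_iff_aestronglyMeasurable]
    rfl
  have : PosSMulMono ℝ (Lp ℝ 2 μ) := ⟨fun a ha f g hfg => by
    simp only [← Lp.coeFn_le] at hfg ⊢
    filter_upwards [hfg, Lp.coeFn_smul a f, Lp.coeFn_smul a g] with ω h1 h2 h3
    rw [h2, h3]
    exact mul_le_mul_of_nonneg_left h1 ha⟩
  have hCconvex : ∀ n, Convex ℝ (C n) := by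
    intro n u hu v hv a b ha hb hab
    refine ⟨fun i => ⟨?_, ?_⟩, ?_, ?_⟩
    · exact Submodule.add_mem _ (Submodule.smul_mem _ _ (hu.1 i).1)
        (Submodule.smul_mem _ _ (hv.1 i).1)
    · exact convex_Icc (𝕜 := ℝ) (-one) one (hu.1 i).2 (hv.1 i).2 ha hb hab
    · have h1 : (-Φ (a • u + b • v)) ⊔ 0 ≤ a • ((-Φ u) ⊔ 0) + b • ((-Φ v) ⊔ 0) := by
        refine sup_le ?_ ?_
        · rw [map_add, map_smul, map_smul, neg_add, ← smul_neg, ← smul_neg]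
          exact add_le_add (smul_le_smul_of_nonneg_left le_sup_left ha)
            (smul_le_smul_of_nonneg_left le_sup_left hb)
        · exact add_nonneg (smul_nonneg ha le_sup_right) (smul_nonneg hb le_sup_right)
      have h2 := hℓmono _ _ h1
      rw [map_add ℓ, map_smul ℓ, map_smul ℓ, smul_eq_mul, smul_eq_mul] at h2
      have h3 : N u ≤ _ := hu.2.1
      have h4 : N v ≤ _ := hv.2.1
      calc N (a • u + b • v) ≤ a * N u + b * N v := h2
        _ ≤ a * (1 / ((n : ℝ) + 1)) + b * (1 / ((n : ℝ) + 1)) := by gcongr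
        _ = _ := by rw [← add_mul, hab, one_mul]
    · rw [map_add, map_smul, map_smul, map_add, map_smul, map_smul, smul_eq_mul, smul_eq_mul]
      calc ε = a * ε + b * ε := by rw [← add_mul, hab, one_mul]
        _ ≤ _ := add_le_add (mul_le_mul_of_nonneg_left hu.2.2 ha)
          (mul_le_mul_of_nonneg_left hv.2.2 hb)
  have hCne : ∀ n, (C n).Nonempty := by
    intro n
    obtain ⟨u, hum, hub, hu1, hu2⟩ := hcon (1 / ((n : ℝ) + 1)) (by positivity)
    have hu : ∀ i, MemLp (u i) 2 μ := fun i =>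
      MemLp.of_bound ((hum i).mono hG le_rfl).aestronglyMeasurable 1 (.of_forall (hub i))
    let w : PiLp 2 (fun _ : ι => Lp ℝ 2 μ) := WithLp.toLp 2 fun i => (hu i).toLp (u i)
    have hw : ∀ᵐ ω ∂μ, ∀ i, w i ω = u i ω := ae_all_iff.2 fun i => (hu i).coeFn_toLp
    refine ⟨w, fun i => ⟨?_, ?_, ?_⟩, ?_, ?_⟩
    · rw [mem_lpMeas_iff_aestronglyMeasurable]
      exact ⟨u i, (hum i).stronglyMeasurable, (hu i).coeFn_toLp⟩
    · rw [← Lp.coeFn_le]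
      filter_upwards [hw, hone, Lp.coeFn_neg one] with ω h1 h2 h3
      rw [h3, Pi.neg_apply, h2, h1]
      exact (abs_le.1 (hub i ω)).1
    · rw [← Lp.coeFn_le]
      filter_upwards [hw, hone] with ω h1 h2
      rw [h2, h1]
      exact (abs_le.1 (hub i ω)).2
    · rw [hN]
      refine le_trans (le_of_eq (integral_congr_ae ?_)) hu1
      filter_upwards [hw] with ω h
      simp only [h]
    · rw [hℓ]
      refine hu2.le.trans (le_of_eq (integral_congr_ae ?_))
      filter_upwards [hw, hΦ w] with ω h h'
      rw [h']
      simp only [h]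
  have hCbdd : ∀ u ∈ C 0, ‖u‖ ≤ √(∑ _i : ι, ‖one‖ ^ 2) := by
    intro u hu
    rw [PiLp.norm_eq_of_L2]
    refine Real.sqrt_le_sqrt (Finset.sum_le_sum fun i _ => ?_)
    refine pow_le_pow_left₀ (norm_nonneg _) (norm_le_norm_of_abs_le_abs ?_) 2
    exact (abs_le'.2 ⟨(hu.1 i).2.2, neg_le.1 (hu.1 i).2.1⟩).trans (le_abs_self _)
  obtain ⟨u, hu⟩ := nonempty_iInter_of_antitone_convex hCmono hCclosed hCconvex hCne hCbdd
  rw [Set.mem_iInter] at hu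
  have hN0 : N u ≤ 0 := ge_of_tendsto' tendsto_one_div_add_atTop_nhds_zero_nat fun n => (hu n).2.1
  have hmeas : ∀ i, AEStronglyMeasurable[G] (u i) μ := fun i =>
    mem_lpMeas_iff_aestronglyMeasurable.1 ((hu 0).1 i).1
  choose θ hθm hθ using hmeas
  have hθ' : ∀ᵐ ω ∂μ, ∀ i, u i ω = θ i ω := ae_all_iff.2 hθ
  have hpos : 0 ≤ᵐ[μ] Φ u := by
    have hint : Integrable ((-Φ u) ⊔ 0 : Lp ℝ 2 μ) μ := (Lp.memLp _).integrable (by norm_num)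
    have hnn : 0 ≤ᵐ[μ] ((-Φ u) ⊔ 0 : Lp ℝ 2 μ) := (Lp.coeFn_nonneg _).2 le_sup_right
    have h0 : ∫ ω, ((-Φ u) ⊔ 0 : Lp ℝ 2 μ) ω ∂μ = 0 :=
      le_antisymm (by rw [← hℓ]; exact hN0) (integral_nonneg_of_ae hnn)
    rw [integral_eq_zero_iff_of_nonneg_ae hnn hint] at h0
    filter_upwards [h0, Lp.coeFn_sup (-Φ u) 0, Lp.coeFn_neg (Φ u)] with ω h1 h2 h3
    rw [h2, Pi.sup_apply, h3, Pi.neg_apply] at h1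
    exact neg_nonpos.1 (le_sup_left.trans h1.le)
  have hzero := hNA θ (fun i => (hθm i).measurable) (by
    filter_upwards [hpos, hΦ u, hθ'] with ω h1 h2 h3
    rw [h2] at h1
    simp only [h3] at h1
    exact h1)
  have h1 : ε ≤ ℓ (Φ u) := (hu 0).2.2
  rw [hℓ, integral_eq_zero_of_ae] at h1
  · exact absurd h1 (not_le.2 hε)
  · filter_upwards [hΦ u, hθ', hzero] with ω h1 h2 h3
    rw [h1]
    simp only [h2]
    exact h3

end

section

variable {Ω ι : Type*} {G m0 : MeasurableSpace Ω} {μ : Measure Ω}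

/-! ### Conditional orthogonalization -/

theorem condExp_sum_mul [IsFiniteMeasure μ] (hG : G ≤ m0) (s : Finset ι) {a f : ι → Ω → ℝ}
    (ha : ∀ i, Measurable[G] (a i)) {C : ℝ} (hab : ∀ i ω, |a i ω| ≤ C)
    (hf : ∀ i, Integrable (f i) μ) :
    μ[fun ω => ∑ i ∈ s, a i ω * f i ω | G] =ᵐ[μ] fun ω => ∑ i ∈ s, a i ω * μ[f i | G] ω := by
  have hint : ∀ i, Integrable (a i * f i) μ := fun i =>
    (hf i).bdd_mul ((ha i).mono hG le_rfl).aestronglyMeasurable (.of_forall (hab i))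
  have h1 : ∀ᵐ ω ∂μ, ∀ i ∈ s, μ[a i * f i | G] ω = a i ω * μ[f i | G] ω :=
    (ae_ball_iff s.countable_toSet).2 fun i _ =>
      condExp_stronglyMeasurable_mul_of_bound hG (ha i).stronglyMeasurable (hf i) C
        (.of_forall (hab i))
  have h2 := condExp_finsetSum (s := s) (fun i _ => hint i) G
  have h3 : (fun ω => ∑ i ∈ s, a i ω * f i ω) = ∑ i ∈ s, a i * f i := by
    ext ω
    simp
  rw [h3]
  filter_upwards [h1, h2] with ω h4 h5
  rw [h5, Finset.sum_apply]
  exact Finset.sum_congr rfl h4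

theorem ae_eq_zero_of_condExp_sq_eq_zero [IsFiniteMeasure μ] (hG : G ≤ m0) {f : Ω → ℝ}
    (hf : Integrable (fun ω => f ω * f ω) μ) :
    ∀ᵐ ω ∂μ, μ[fun ω => f ω * f ω | G] ω = 0 → f ω = 0 := by
  set q := μ[fun ω => f ω * f ω | G]
  have hA : MeasurableSet[G] {ω | q ω = 0} :=
    stronglyMeasurable_condExp.measurable (measurableSet_singleton 0)
  have h1 : ∫ ω in {ω | q ω = 0}, f ω * f ω ∂μ = 0 := by
    rw [← setIntegral_condExp hG hf hA]
    exact setIntegral_eq_zero_of_forall_eq_zero fun ω hω => hω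
  rw [setIntegral_eq_zero_iff_of_nonneg_ae (.of_forall fun ω => mul_self_nonneg _)
    hf.integrableOn] at h1
  filter_upwards [(ae_restrict_iff' (hG _ hA)).1 h1] with ω h2 h3
  exact mul_self_eq_zero.1 (h2 h3)

theorem condExp_eq_zero_of_ae_eq_zero_on {f : Ω → ℝ} (hf : Integrable f μ) {A : Set Ω}
    (hA : MeasurableSet[G] A) (h0 : ∀ᵐ ω ∂μ, ω ∈ A → f ω = 0) :
    ∀ᵐ ω ∂μ, ω ∈ A → μ[f | G] ω = 0 := by
  have h1 : A.indicator f =ᵐ[μ] 0 := by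
    filter_upwards [h0] with ω h
    by_cases hω : ω ∈ A <;> simp [hω, h]
  have h2 := (condExp_indicator hf hA).symm.trans (condExp_congr_ae h1)
  rw [condExp_zero] at h2
  filter_upwards [h2] with ω h hω
  simpa [hω] using h

/-- Gram–Schmidt orthogonalization with respect to the conditional expectation, performed for the
price increments with index in `s`. The new increments have the same `G`-linear span, so absence of
arbitrage passes to them, and a pricing density for them is one for the old increments. Each new
vector is multiplied by a positive `G`-measurable weight in order to stay bounded. -/
theorem exists_condExp_orthogonal [Fintype ι] [IsFiniteMeasure μ] (hG : G ≤ m0)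
    {X : ι → Ω → ℝ} (hXm : ∀ i, Measurable (X i)) {c : ℝ} (hXb : ∀ i ω, |X i ω| ≤ c)
    (s : Finset ι) :
    ∃ Y : ι → Ω → ℝ, (∀ i, Measurable (Y i)) ∧ (∃ c, ∀ i ω, |Y i ω| ≤ c) ∧
      (∀ i ∈ s, ∀ j ∈ s, i ≠ j → μ[fun ω => Y i ω * Y j ω | G] =ᵐ[μ] 0) ∧
      (NoArbitrageStep G μ X → NoArbitrageStep G μ Y) ∧
      ∀ Z : Ω → ℝ, Integrable Z μ → (∀ i, μ[fun ω => Z ω * Y i ω | G] =ᵐ[μ] 0) →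
        ∀ i, μ[fun ω => Z ω * X i ω | G] =ᵐ[μ] 0 := by
  classical
  induction s using Finset.induction_on with
  | empty => exact ⟨X, hXm, ⟨c, hXb⟩, by simp, id, fun _ _ h => h⟩
  | insert k s hk ih =>
    obtain ⟨Y, hYm, ⟨K, hYb⟩, horth, hNA, hZ⟩ := ih
    have hYY : ∀ i j, Integrable (fun ω => Y i ω * Y j ω) μ := fun i j =>
      Integrable.of_bound ((hYm i).mul (hYm j)).aestronglyMeasurable (K * K) (.of_forall fun ω => by
        rw [norm_mul]
        exact mul_le_mul (hYb i ω) (hYb j ω) (norm_nonneg _) ((abs_nonneg _).trans (hYb i ω)))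
    let b : ι → ι → Ω → ℝ := fun i j => μ[fun ω => Y i ω * Y j ω | G]
    have hbm : ∀ i j, Measurable[G] (b i j) := fun i j => stronglyMeasurable_condExp.measurable
    let C : Ω → ℝ := fun ω => 1 + ∑ j ∈ s, |b k j ω / b j j ω|
    have hC1 : ∀ ω, 1 ≤ C ω := fun ω =>
      le_add_of_nonneg_right (Finset.sum_nonneg fun _ _ => abs_nonneg _)
    have hCj : ∀ j ∈ s, ∀ ω, |b k j ω / b j j ω| ≤ C ω := fun j hj ω =>
      (Finset.single_le_sum (f := fun j => |b k j ω / b j j ω|) (fun _ _ => abs_nonneg _) hj).trans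
        (le_add_of_nonneg_left zero_le_one)
    have hCm : Measurable[G] C :=
      measurable_const.add (Finset.measurable_fun_sum s fun j _ =>
        measurable_norm.comp ((hbm k j).div (hbm j j)))
    -- the coefficients of `Y k` minus its projection, divided by `C` in order to be bounded by `1`;
    -- where `b l l = 0` the quotient is `0`, as it should be, because `Y l` vanishes there
    let a : ι → Ω → ℝ := fun l ω =>
      if l = k then (C ω)⁻¹ else if l ∈ s then -((b k l ω / b l l ω) / C ω) else 0
    have ham : ∀ l, Measurable[G] (a l) := by
      intro l
      by_cases h1 : l = k
      · simp only [a, h1, if_true]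
        exact hCm.inv
      · by_cases h2 : l ∈ s
        · simp only [a, h1, h2, if_true, if_false]
          exact (((hbm k l).div (hbm l l)).div hCm).neg
        · simpa only [a, h1, h2, if_false] using measurable_const
    have hab : ∀ l ω, |a l ω| ≤ 1 := by
      intro l ω
      have hpos : 0 < C ω := zero_lt_one.trans_le (hC1 ω)
      by_cases h1 : l = k
      · simp only [a, h1, if_true]
        rw [abs_of_pos (inv_pos.2 hpos)]
        exact inv_le_one_of_one_le₀ (hC1 ω)
      · by_cases h2 : l ∈ s
        · simp only [a, h1, h2, if_true, if_false]
          rw [abs_neg, abs_div, abs_of_pos hpos]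
          exact div_le_one_of_le₀ (hCj l h2 ω) hpos.le
        · simp [a, h1, h2]
    have hak : ∀ ω, a k ω = (C ω)⁻¹ := fun ω => if_pos rfl
    let R : Ω → ℝ := fun ω => ∑ l ∈ insert k s, a l ω * Y l ω
    have hRm : Measurable R :=
      Finset.measurable_fun_sum _ fun l _ => ((ham l).mono hG le_rfl).mul (hYm l)
    have hRb : ∀ ω, |R ω| ≤ ∑ _l ∈ insert k s, K := fun ω =>
      (Finset.abs_sum_le_sum_abs _ _).trans (Finset.sum_le_sum fun l _ => by
        rw [abs_mul]
        exact (mul_le_of_le_one_left (abs_nonneg _) (hab l ω)).trans (hYb l ω))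
    have hR : ∀ j ∈ s, μ[fun ω => R ω * Y j ω | G] =ᵐ[μ] 0 := by
      intro j hj
      have hjk : j ≠ k := fun h => hk (h ▸ hj)
      have h1 := condExp_sum_mul hG (insert k s) ham hab (fun l => hYY l j)
      have h2 : (fun ω => R ω * Y j ω) =
          fun ω => ∑ l ∈ insert k s, a l ω * (Y l ω * Y j ω) := by
        ext ω
        simp only [R, Finset.sum_mul, mul_assoc]
      have h3 : ∀ᵐ ω ∂μ, ∀ l ∈ s, l ≠ j → b l j ω = 0 :=
        (ae_ball_iff s.countable_toSet).2 fun l hl => by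
          by_cases hlj : l = j
          · exact .of_forall fun ω h => absurd hlj h
          · filter_upwards [horth l hl j hj hlj] with ω h _ using h
      have h4 : ∀ᵐ ω ∂μ, b j j ω = 0 → b k j ω = 0 :=
        condExp_eq_zero_of_ae_eq_zero_on (hYY k j) (hbm j j (measurableSet_singleton 0)) (by
          filter_upwards [ae_eq_zero_of_condExp_sq_eq_zero hG (hYY j j)] with ω h hω
          rw [h hω, mul_zero])
      rw [h2]
      filter_upwards [h1, h3, h4] with ω h5 h6 h7
      rw [h5, Finset.sum_insert hk, Finset.sum_eq_single_of_mem j hj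
        (fun l hl hlj => by
          rw [show μ[fun ω => Y l ω * Y j ω | G] ω = 0 from h6 l hl hlj, mul_zero])]
      change a k ω * b k j ω + a j ω * b j j ω = 0
      simp only [a, if_true, hjk, hj, if_false]
      by_cases h0 : b j j ω = 0
      · rw [h0, h7 h0]
        simp
      · field_simp
        ring
    refine ⟨Function.update Y k R, ?_, ⟨max K (∑ _l ∈ insert k s, K), ?_⟩, ?_, ?_, ?_⟩
    · intro i
      by_cases h : i = k
      · subst h
        simpa using hRm
      · simpa [h] using hYm i
    · intro i ω
      by_cases h : i = k
      · subst h
        simpa using Or.inr (by simpa using hRb ω)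
      · simpa [h] using Or.inl (hYb i ω)
    · intro i hi j hj hij
      by_cases h : i = k
      · subst h
        have hj' : j ∈ s := (Finset.mem_insert.1 hj).resolve_left (Ne.symm hij)
        simpa [Function.update_of_ne (Ne.symm hij)] using hR j hj'
      · have hi' : i ∈ s := (Finset.mem_insert.1 hi).resolve_left h
        by_cases h' : j = k
        · subst h'
          simpa [h, mul_comm] using hR i hi'
        · have hj' : j ∈ s := (Finset.mem_insert.1 hj).resolve_left h'
          simpa [h, h'] using horth i hi' j hj' hij
    · intro hX θ hθ
      let θ' : ι → Ω → ℝ := fun i ω =>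
        (if i = k then 0 else θ i ω) + (if i ∈ insert k s then θ k ω * a i ω else 0)
      have hθ' : ∀ i, Measurable[G] (θ' i) := by
        intro i
        refine Measurable.add ?_ ?_
        · by_cases h : i = k
          · simp only [h, if_true]
            exact measurable_const
          · simpa only [h, if_false] using hθ i
        · by_cases h : i ∈ insert k s
          · simp only [h, if_true]
            exact (hθ k).mul (ham i)
          · simp only [h, if_false]
            exact measurable_const
      have hsum : ∀ ω, ∑ i, θ i ω * Function.update Y k R i ω = ∑ i, θ' i ω * Y i ω := by
        intro ω
        have e1 : ∑ i, θ' i ω * Y i ω = ∑ i, (if i = k then 0 else θ i ω * Y i ω) +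
            ∑ i ∈ insert k s, θ k ω * (a i ω * Y i ω) := by
          rw [← Finset.sum_filter_add_sum_filter_not Finset.univ (· ∈ insert k s)
            (fun i => θ' i ω * Y i ω), ← Finset.sum_filter_add_sum_filter_not Finset.univ
            (· ∈ insert k s) (fun i => if i = k then 0 else θ i ω * Y i ω), add_right_comm,
            Finset.filter_mem_eq_inter, Finset.univ_inter, ← Finset.sum_add_distrib]
          congr 1
          · refine Finset.sum_congr rfl fun i hi => ?_
            simp only [θ', hi, if_true]
            split_ifs <;> ring
          · refine Finset.sum_congr rfl fun i hi => ?_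
            simp only [θ', (Finset.mem_filter.1 hi).2, if_false]
            split_ifs <;> ring
        rw [e1, ← Finset.mul_sum, ← Finset.add_sum_erase _ _ (Finset.mem_univ k),
          ← Finset.add_sum_erase (a := k) _ (fun i => if i = k then 0 else θ i ω * Y i ω)
            (Finset.mem_univ k)]
        simp only [Function.update_self, if_true, zero_add]
        rw [add_comm]
        congr 1
        refine Finset.sum_congr rfl fun i hi => ?_
        rw [Function.update_of_ne (Finset.ne_of_mem_erase hi), if_neg (Finset.ne_of_mem_erase hi)]
      simp only [hsum]
      exact hNA hX θ' hθ'
    · intro Z hZi hZ0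
      refine hZ Z hZi fun i => ?_
      have hother : ∀ i, i ≠ k → μ[fun ω => Z ω * Y i ω | G] =ᵐ[μ] 0 := fun i hi => by
        simpa [hi] using hZ0 i
      by_cases h : i = k
      · subst h
        have hZY : ∀ l, Integrable (fun ω => Z ω * Y l ω) μ := fun l =>
          hZi.mul_bdd (hYm l).aestronglyMeasurable (.of_forall (hYb l))
        have h1 := condExp_sum_mul hG (insert i s) ham hab hZY
        have h2 : (fun ω => ∑ l ∈ insert i s, a l ω * (Z ω * Y l ω)) = fun ω => Z ω * R ω := by
          ext ω
          simp only [R, Finset.mul_sum]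
          exact Finset.sum_congr rfl fun l _ => by ring
        have h3 : ∀ᵐ ω ∂μ, ∀ l ∈ s, μ[fun ω => Z ω * Y l ω | G] ω = 0 :=
          (ae_ball_iff s.countable_toSet).2 fun l hl => hother l fun h => hk (h ▸ hl)
        have h4 : μ[fun ω => Z ω * R ω | G] =ᵐ[μ] 0 := by simpa using hZ0 i
        rw [h2] at h1
        filter_upwards [h1, h3, h4] with ω h5 h6 h7
        rw [h5, Finset.sum_insert hk, Finset.sum_eq_zero fun l hl => by rw [h6 l hl, mul_zero],
          add_zero, hak] at h7
        exact (mul_eq_zero.1 h7).resolve_left (inv_ne_zero (by linarith [hC1 ω]))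
      · exact hother i h

end

section

variable {Ω ι : Type*} {G m0 : MeasurableSpace Ω} {μ : Measure Ω}

/-! ### No free lunch over a single period -/

theorem exists_seq_tendsto_ae_zero_of_integral_abs {f : ℕ → Ω → ℝ} (hf : ∀ n, Integrable (f n) μ)
    (h : Tendsto (fun n => ∫ ω, |f n ω| ∂μ) atTop (𝓝 0)) :
    ∃ ns : ℕ → ℕ, StrictMono ns ∧ ∀ᵐ ω ∂μ, Tendsto (fun n => f (ns n) ω) atTop (𝓝 0) := by
  refine (tendstoInMeasure_of_tendsto_eLpNorm (p := 1) (g := 0) one_ne_zero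
    (fun n => (hf n).aestronglyMeasurable) aestronglyMeasurable_zero ?_).exists_seq_tendsto_ae
  have h1 : ∀ n, eLpNorm (f n - 0) 1 μ = ENNReal.ofReal (∫ ω, |f n ω| ∂μ) := fun n => by
    rw [sub_zero, eLpNorm_one_eq_lintegral_enorm]
    exact (ofReal_integral_norm_eq_lintegral_enorm (hf n)).symm
  simp only [h1]
  simpa using ENNReal.tendsto_ofReal h

variable [Fintype ι] [IsFiniteMeasure μ]

/-- Positions bounded by `1` whose losses tend to `0` in `L¹` tend to `0` themselves along a
subsequence, provided that the increments are conditionally orthogonal and that nothing is held of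
an increment while it vanishes. -/
theorem NoArbitrageStep.exists_seq_position_tendsto_zero (hG : G ≤ m0) {Y : ι → Ω → ℝ}
    (hNA : NoArbitrageStep G μ Y) (hYm : ∀ i, Measurable (Y i)) {c : ℝ} (hYb : ∀ i ω, |Y i ω| ≤ c)
    (horth : ∀ i j, i ≠ j → μ[fun ω => Y i ω * Y j ω | G] =ᵐ[μ] 0)
    {u : ℕ → ι → Ω → ℝ} (hum : ∀ n i, Measurable[G] (u n i)) (hub : ∀ n i ω, |u n i ω| ≤ 1)
    (hu0 : ∀ n i ω, μ[fun ω => Y i ω * Y i ω | G] ω = 0 → u n i ω = 0)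
    (hloss : Tendsto (fun n => ∫ ω, max (-∑ i, u n i ω * Y i ω) 0 ∂μ) atTop (𝓝 0)) :
    ∃ ns : ℕ → ℕ, StrictMono ns ∧
      ∀ᵐ ω ∂μ, ∀ i, Tendsto (fun n => u (ns n) i ω) atTop (𝓝 0) := by
  let y : ℕ → Ω → ℝ := fun n ω => ∑ i, u n i ω * Y i ω
  have hum' : ∀ n i, Measurable (u n i) := fun n i => (hum n i).mono hG le_rfl
  have hym : ∀ n, Measurable (y n) := fun n =>
    Finset.measurable_fun_sum _ fun i _ => (hum' n i).mul (hYm i)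
  have hyb : ∀ n ω, |y n ω| ≤ ∑ _i : ι, c := fun n ω =>
    (Finset.abs_sum_le_sum_abs _ _).trans (Finset.sum_le_sum fun i _ => by
      rw [abs_mul]
      exact (mul_le_of_le_one_left (abs_nonneg _) (hub n i ω)).trans (hYb i ω))
  have hyi : ∀ n, Integrable (y n) μ := fun n =>
    Integrable.of_bound (hym n).aestronglyMeasurable _ (.of_forall (hyb n))
  have hli : ∀ n, Integrable (fun ω => max (-y n ω) 0) μ := fun n => (hyi n).neg.pos_part
  have hYY : ∀ i j, Integrable (fun ω => Y i ω * Y j ω) μ := fun i j =>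
    Integrable.of_bound ((hYm i).mul (hYm j)).aestronglyMeasurable (c * c) (.of_forall fun ω => by
      rw [norm_mul]
      exact mul_le_mul (hYb i ω) (hYb j ω) (norm_nonneg _) ((abs_nonneg _).trans (hYb i ω)))
  -- the gains tend to zero in `L¹`, because the losses do
  have habs : Tendsto (fun n => ∫ ω, |y n ω| ∂μ) atTop (𝓝 0) := by
    have heq : ∀ n, ∫ ω, |y n ω| ∂μ = ∫ ω, y n ω ∂μ + 2 * ∫ ω, max (-y n ω) 0 ∂μ := by
      intro n
      rw [← integral_const_mul, ← integral_add (hyi n) ((hli n).const_mul 2)]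
      refine integral_congr_ae (.of_forall fun ω => ?_)
      rcases le_total 0 (y n ω) with h | h
      · simp [abs_of_nonneg h, h]
      · simp only [abs_of_nonpos h, max_eq_left (neg_nonneg.2 h)]
        ring
    rw [Metric.tendsto_atTop]
    intro ε hε
    obtain ⟨δ, hδ, hδε⟩ := hNA.exists_integral_le hG hYm hYb (half_pos hε)
    have hmin : 0 < min δ (ε / 4) := lt_min hδ (by linarith)
    obtain ⟨N, hN⟩ := eventually_atTop.1 (hloss.eventually (gt_mem_nhds hmin))
    refine ⟨N, fun n hn => ?_⟩
    have h1 := hN n hn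
    have h2 := hδε (u n) (hum n) (hub n) (h1.le.trans (min_le_left _ _))
    have h3 : ∫ ω, max (-y n ω) 0 ∂μ < ε / 4 := h1.trans_le (min_le_right _ _)
    have h4 : ∫ ω, y n ω ∂μ ≤ ε / 2 := h2
    have h5 : 0 ≤ ∫ ω, |y n ω| ∂μ := integral_nonneg fun ω => abs_nonneg _
    rw [Real.dist_eq, sub_zero, abs_of_nonneg h5, heq]
    linarith
  -- conditional orthogonality recovers the position from the gain
  let q : ι → Ω → ℝ := fun i => μ[fun ω => Y i ω * Y i ω | G]
  have hproj : ∀ n i, μ[fun ω => y n ω * Y i ω | G] =ᵐ[μ] fun ω => u n i ω * q i ω := by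
    intro n i
    have h1 := condExp_sum_mul hG Finset.univ (hum n) (hub n) (fun j => hYY j i)
    have h2 : (fun ω => ∑ j, u n j ω * (Y j ω * Y i ω)) = fun ω => y n ω * Y i ω := by
      ext ω
      simp only [y, Finset.sum_mul, mul_assoc]
    rw [h2] at h1
    have h3 : ∀ᵐ ω ∂μ, ∀ j, j ≠ i → μ[fun ω => Y j ω * Y i ω | G] ω = 0 := by
      rw [ae_all_iff]
      intro j
      by_cases hj : j = i
      · exact .of_forall fun ω h => absurd hj h
      · filter_upwards [horth j i hj] with ω h _ using h
    filter_upwards [h1, h3] with ω h4 h5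
    rw [h4, Finset.sum_eq_single i (fun j _ hj => by rw [h5 j hj, mul_zero])
      (fun h => absurd (Finset.mem_univ i) h)]
  have hyY : ∀ n i, Integrable (fun ω => y n ω * Y i ω) μ := fun n i =>
    (hyi n).mul_bdd (hYm i).aestronglyMeasurable (.of_forall (hYb i))
  have huq : ∀ n i, Integrable (fun ω => u n i ω * q i ω) μ := fun n i =>
    integrable_condExp.congr (hproj n i)
  have huq_le : ∀ n i, ∫ ω, |u n i ω * q i ω| ∂μ ≤ c * ∫ ω, |y n ω| ∂μ := by
    intro n i
    have h1 : ∫ ω, |u n i ω * q i ω| ∂μ = ∫ ω, |μ[fun ω => y n ω * Y i ω | G] ω| ∂μ :=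
      integral_congr_ae (by filter_upwards [hproj n i] with ω h; rw [h])
    rw [h1, ← integral_const_mul]
    refine (integral_abs_condExp_le _).trans (integral_mono (hyY n i).abs
      ((hyi n).abs.const_mul c) fun ω => ?_)
    change |y n ω * Y i ω| ≤ c * |y n ω|
    rw [abs_mul, mul_comm]
    exact mul_le_mul_of_nonneg_right (hYb i ω) (abs_nonneg _)
  let h : ℕ → Ω → ℝ := fun n ω => ∑ i, |u n i ω * q i ω|
  have hh : Tendsto (fun n => ∫ ω, |h n ω| ∂μ) atTop (𝓝 0) := by
    have h0 : Tendsto (fun n => ∑ _i : ι, c * ∫ ω, |y n ω| ∂μ) atTop (𝓝 0) := by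
      simpa using tendsto_finsetSum (Finset.univ : Finset ι) fun i _ => habs.const_mul c
    refine squeeze_zero (fun n => integral_nonneg fun ω => abs_nonneg _) (fun n => ?_) h0
    have h1 : ∀ ω, |h n ω| = ∑ i, |u n i ω * q i ω| := fun ω =>
      abs_of_nonneg (Finset.sum_nonneg fun _ _ => abs_nonneg _)
    simp only [h1]
    rw [integral_finsetSum _ fun i _ => (huq n i).abs]
    exact Finset.sum_le_sum fun i _ => huq_le n i
  obtain ⟨ns, hns, hlim⟩ := exists_seq_tendsto_ae_zero_of_integral_abs
    (fun n => integrable_finsetSum _ fun i _ => (huq n i).abs) hh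
  refine ⟨ns, hns, ?_⟩
  filter_upwards [hlim] with ω hω i
  by_cases hq : q i ω = 0
  · simp only [hu0 _ i ω hq]
    exact tendsto_const_nhds
  · have h1 : Tendsto (fun n => |u (ns n) i ω * q i ω|) atTop (𝓝 0) :=
      squeeze_zero (fun n => abs_nonneg _) (fun n =>
        Finset.single_le_sum (f := fun i => |u (ns n) i ω * q i ω|) (fun _ _ => abs_nonneg _)
          (Finset.mem_univ i)) hω
    have h2 := ((tendsto_zero_iff_abs_tendsto_zero _).2 h1).mul_const (q i ω)⁻¹
    simpa [mul_assoc, hq] using h2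

/-- Random variables dominated by gains of arbitrary positions cannot converge to a nonnegative
limit other than zero. The gains are controlled after dividing the positions by one plus their
size: the normalized positions tend to zero, and then so do the original ones. -/
theorem NoArbitrageStep.limit_nonpos (hG : G ≤ m0) {Y : ι → Ω → ℝ}
    (hNA : NoArbitrageStep G μ Y) (hYm : ∀ i, Measurable (Y i)) {c : ℝ} (hYb : ∀ i ω, |Y i ω| ≤ c)
    (horth : ∀ i j, i ≠ j → μ[fun ω => Y i ω * Y j ω | G] =ᵐ[μ] 0)
    {u : ℕ → ι → Ω → ℝ} (hum : ∀ n i, Measurable[G] (u n i)) {f : ℕ → Ω → ℝ} {g : Ω → ℝ}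
    (hfu : ∀ n, ∀ᵐ ω ∂μ, f n ω ≤ ∑ i, u n i ω * Y i ω)
    (hfg : ∀ᵐ ω ∂μ, Tendsto (fun n => f n ω) atTop (𝓝 (g ω))) (hg : ∀ᵐ ω ∂μ, 0 ≤ g ω) :
    ∀ᵐ ω ∂μ, g ω ≤ 0 := by
  classical
  let q : ι → Ω → ℝ := fun i => μ[fun ω => Y i ω * Y i ω | G]
  have hqm : ∀ i, Measurable[G] (q i) := fun i => stronglyMeasurable_condExp.measurable
  -- hold nothing of an increment while it vanishes, which does not change the gain
  let v : ℕ → ι → Ω → ℝ := fun n i => {ω | q i ω = 0}ᶜ.indicator (u n i)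
  have hvm : ∀ n i, Measurable[G] (v n i) := fun n i =>
    (hum n i).indicator ((hqm i) (measurableSet_singleton 0)).compl
  let r : ℕ → Ω → ℝ := fun n ω => 1 + ∑ i, |v n i ω|
  have hr1 : ∀ n ω, 1 ≤ r n ω := fun n ω =>
    le_add_of_nonneg_right (Finset.sum_nonneg fun _ _ => abs_nonneg _)
  have hr0 : ∀ n ω, 0 < r n ω := fun n ω => zero_lt_one.trans_le (hr1 n ω)
  have hrm : ∀ n, Measurable[G] (r n) := fun n =>
    measurable_const.add (Finset.measurable_fun_sum _ fun i _ => measurable_norm.comp (hvm n i))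
  let w : ℕ → ι → Ω → ℝ := fun n i ω => v n i ω / r n ω
  have hwm : ∀ n i, Measurable[G] (w n i) := fun n i => (hvm n i).div (hrm n)
  have hwb : ∀ n i ω, |w n i ω| ≤ 1 := fun n i ω => by
    rw [abs_div, abs_of_pos (hr0 n ω)]
    refine div_le_one_of_le₀ ?_ (hr0 n ω).le
    exact (Finset.single_le_sum (f := fun i => |v n i ω|) (fun _ _ => abs_nonneg _)
      (Finset.mem_univ i)).trans (le_add_of_nonneg_left zero_le_one)
  have hw0 : ∀ n i ω, q i ω = 0 → w n i ω = 0 := fun n i ω h => by simp [w, v, h]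
  have hYY : ∀ i, Integrable (fun ω => Y i ω * Y i ω) μ := fun i =>
    Integrable.of_bound ((hYm i).mul (hYm i)).aestronglyMeasurable (c * c) (.of_forall fun ω => by
      rw [norm_mul]
      exact mul_le_mul (hYb i ω) (hYb i ω) (norm_nonneg _) ((abs_nonneg _).trans (hYb i ω)))
  have hvu : ∀ᵐ ω ∂μ, ∀ n, ∑ i, v n i ω * Y i ω = ∑ i, u n i ω * Y i ω := by
    have h1 : ∀ᵐ ω ∂μ, ∀ i, q i ω = 0 → Y i ω = 0 :=
      ae_all_iff.2 fun i => ae_eq_zero_of_condExp_sq_eq_zero hG (hYY i)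
    filter_upwards [h1] with ω h n
    refine Finset.sum_congr rfl fun i _ => ?_
    by_cases hq : q i ω = 0
    · rw [h i hq, mul_zero, mul_zero]
    · simp [v, hq]
  have hwv : ∀ n ω, ∑ i, w n i ω * Y i ω = (∑ i, v n i ω * Y i ω) / r n ω := fun n ω => by
    rw [Finset.sum_div]
    exact Finset.sum_congr rfl fun i _ => by ring
  have hfu' := ae_all_iff.2 hfu
  have hloss : Tendsto (fun n => ∫ ω, max (-∑ i, w n i ω * Y i ω) 0 ∂μ) atTop (𝓝 0) := by
    have hwm' : ∀ n i, Measurable (w n i) := fun n i => (hwm n i).mono hG le_rfl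
    have hdom := tendsto_integral_of_dominated_convergence (μ := μ) (f := fun _ => (0 : ℝ))
      (F := fun n ω => max (-∑ i, w n i ω * Y i ω) 0) (fun _ => ∑ _i : ι, c)
      (fun n => ((Finset.measurable_fun_sum _ fun i _ => (hwm' n i).mul (hYm i)).neg.max
        measurable_const).aestronglyMeasurable) (integrable_const _)
      (fun n => .of_forall fun ω => ?_) ?_
    · simpa using hdom
    · have h1 : |∑ i, w n i ω * Y i ω| ≤ ∑ _i : ι, c :=
        (Finset.abs_sum_le_sum_abs _ _).trans (Finset.sum_le_sum fun i _ => by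
          rw [abs_mul]
          exact (mul_le_of_le_one_left (abs_nonneg _) (hwb n i ω)).trans (hYb i ω))
      rw [Real.norm_of_nonneg (le_max_right _ _)]
      exact max_le ((neg_le_abs _).trans h1) ((abs_nonneg _).trans h1)
    · filter_upwards [hvu, hfu', hfg, hg] with ω h1 h2 h3 h4
      have h5 : Tendsto (fun n => max (-f n ω) 0) atTop (𝓝 0) := by
        have := (h3.neg.max (tendsto_const_nhds (x := (0 : ℝ))))
        rwa [max_eq_right (neg_nonpos.2 h4)] at this
      refine squeeze_zero (fun n => le_max_right _ _) (fun n => ?_) h5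
      rw [hwv, h1 n, ← neg_div]
      refine max_le ?_ (le_max_right _ _)
      have h6 : -∑ i, u n i ω * Y i ω ≤ max (-f n ω) 0 :=
        (neg_le_neg (h2 n)).trans (le_max_left _ _)
      calc (-∑ i, u n i ω * Y i ω) / r n ω ≤ max (-f n ω) 0 / r n ω :=
            div_le_div_of_nonneg_right h6 (hr0 n ω).le
        _ ≤ max (-f n ω) 0 := div_le_self (le_max_right _ _) (hr1 n ω)
  obtain ⟨ns, hns, hlim⟩ :=
    hNA.exists_seq_position_tendsto_zero hG hYm hYb horth hwm hwb hw0 hloss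
  filter_upwards [hvu, hfu', hfg, hlim] with ω h1 h2 h3 h4
  -- the sizes satisfy `∑ |w| = 1 - 1 / r`, so that `r → 1` and `v = r w → 0`
  have hrinv : Tendsto (fun n => (r (ns n) ω)⁻¹) atTop (𝓝 1) := by
    have h5 : ∀ n, (r (ns n) ω)⁻¹ = 1 - ∑ i, |w (ns n) i ω| := by
      intro n
      have h6 : ∑ i, |w (ns n) i ω| = (∑ i, |v (ns n) i ω|) / r (ns n) ω := by
        rw [Finset.sum_div]
        exact Finset.sum_congr rfl fun i _ => by rw [abs_div, abs_of_pos (hr0 _ ω)]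
      have h7 : ∑ i, |v (ns n) i ω| = r (ns n) ω - 1 := by simp [r]
      rw [h6, h7, sub_div, div_self (hr0 _ ω).ne', one_div, sub_sub_cancel]
    simp only [h5]
    simpa using (tendsto_finsetSum (Finset.univ : Finset ι) fun i _ => (h4 i).abs).const_sub 1
  have hy : Tendsto (fun n => ∑ i, u (ns n) i ω * Y i ω) atTop (𝓝 0) := by
    have h5 : ∀ n, ∑ i, u (ns n) i ω * Y i ω =
        (r (ns n) ω)⁻¹⁻¹ * ∑ i, w (ns n) i ω * Y i ω := by
      intro n
      rw [hwv, h1, inv_inv, mul_div_cancel₀ _ (hr0 _ ω).ne']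
    simp only [h5]
    have h6 : Tendsto (fun n => ∑ i, w (ns n) i ω * Y i ω) atTop (𝓝 0) := by
      simpa using tendsto_finsetSum (Finset.univ : Finset ι) fun i _ => (h4 i).mul_const (Y i ω)
    simpa using (hrinv.inv₀ one_ne_zero).mul h6
  exact le_of_tendsto_of_tendsto' (h3.comp hns.tendsto_atTop) hy fun n => h2 (ns n)

end

section

variable {Ω ι : Type*} {G m0 : MeasurableSpace Ω} {μ : Measure Ω} [IsFiniteMeasure μ]

/-! ### Strictly positive elements of dual cones -/

/-- Exhaustion: in a closed cone of nonnegative `L²` functions that charges every set of positive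
measure, a countable positive combination of functions whose supports have almost maximal measure is
positive everywhere. -/
theorem exists_mem_properCone_pos (D : ProperCone ℝ (Lp ℝ 2 μ)) (hD : ∀ Z ∈ D, 0 ≤ Z)
    (h : ∀ A, MeasurableSet A → μ A ≠ 0 → ∃ Z ∈ D, ¬ ∀ᵐ ω ∂μ, ω ∈ A → Z ω ≤ 0) :
    ∃ Z ∈ D, ∀ᵐ ω ∂μ, 0 < Z ω := by
  have hsm : ∀ Z : Lp ℝ 2 μ, MeasurableSet {ω | 0 < Z ω} := fun Z =>
    measurableSet_lt measurable_const (Lp.stronglyMeasurable Z).measurable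
  let S : Set ℝ := (fun Z : Lp ℝ 2 μ => μ.real {ω | 0 < Z ω}) '' (D : Set (Lp ℝ 2 μ))
  have hSne : S.Nonempty := ⟨_, 0, zero_mem D, rfl⟩
  have hSbdd : BddAbove S := by
    refine ⟨μ.real Set.univ, ?_⟩
    rintro _ ⟨Z, -, rfl⟩
    exact measureReal_mono (Set.subset_univ _)
  have hex : ∀ n : ℕ, ∃ Z ∈ D, sSup S - 1 / ((n : ℝ) + 1) < μ.real {ω | 0 < Z ω} := by
    intro n
    obtain ⟨_, ⟨Z, hZ, rfl⟩, hlt⟩ := exists_lt_of_lt_csSup hSne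
      (sub_lt_self (sSup S) (by positivity : (0 : ℝ) < 1 / ((n : ℝ) + 1)))
    exact ⟨Z, hZ, hlt⟩
  choose Z hZD hZ using hex
  let a : ℕ → ℝ := fun n => (1 / 2) ^ n / (1 + ‖Z n‖)
  have ha : ∀ n, 0 < a n := fun n => by positivity
  have hterm : ∀ n, a n • Z n ∈ D := fun n => D.toSubmodule.smul_mem ⟨a n, (ha n).le⟩ (hZD n)
  have hsum : Summable fun n => a n • Z n := by
    refine Summable.of_norm_bounded summable_geometric_two fun n => ?_
    rw [norm_smul, Real.norm_of_nonneg (ha n).le, div_mul_eq_mul_div]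
    refine div_le_of_le_mul₀ (by positivity) (by positivity) ?_
    exact mul_le_mul_of_nonneg_left (by linarith [norm_nonneg (Z n)]) (by positivity)
  set W := ∑' n, a n • Z n
  have hWD : W ∈ D := D.isClosed.mem_of_tendsto hsum.hasSum
    (.of_forall fun s => D.toSubmodule.sum_mem fun n _ => hterm n)
  have hle : ∀ n, a n • Z n ≤ W := fun n => hsum.le_tsum n fun j _ => hD _ (hterm j)
  have hsub : ∀ n, ∀ᵐ ω ∂μ, 0 < Z n ω → 0 < W ω := by
    intro n
    filter_upwards [(Lp.coeFn_le _ _).2 (hle n), Lp.coeFn_smul (a n) (Z n)] with ω h1 h2 h3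
    rw [h2] at h1
    exact (mul_pos (ha n) h3).trans_le h1
  have hWmax : sSup S ≤ μ.real {ω | 0 < W ω} := by
    have h1 : ∀ n : ℕ, sSup S - 1 / ((n : ℝ) + 1) ≤ μ.real {ω | 0 < W ω} := fun n =>
      (hZ n).le.trans (ENNReal.toReal_mono (measure_ne_top _ _) (measure_mono_ae (hsub n)))
    have h2 : Tendsto (fun n : ℕ => sSup S - 1 / ((n : ℝ) + 1)) atTop (𝓝 (sSup S)) := by
      simpa using (tendsto_one_div_add_atTop_nhds_zero_nat (𝕜 := ℝ)).const_sub (sSup S)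
    exact le_of_tendsto' h2 h1
  refine ⟨W, hWD, ?_⟩
  by_contra hcon
  have hA : MeasurableSet {ω | 0 < W ω}ᶜ := (hsm W).compl
  obtain ⟨V, hVD, hV⟩ := h _ hA fun h0 => hcon h0
  have hVW : μ.real {ω | 0 < (W + V) ω} ≤ sSup S := le_csSup hSbdd ⟨_, add_mem hWD hVD, rfl⟩
  have hWnn := (Lp.coeFn_nonneg _).2 (hD W hWD)
  have hVnn := (Lp.coeFn_nonneg _).2 (hD V hVD)
  have h1 : ({ω | 0 < W ω} ∪ ({ω | 0 < W ω}ᶜ ∩ {ω | 0 < V ω}) : Set Ω) ≤ᵐ[μ]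
      {ω | 0 < (W + V) ω} := by
    filter_upwards [hWnn, hVnn, Lp.coeFn_add W V] with ω h2 h3 h4 h5
    change 0 < (W + V) ω
    rw [h4, Pi.add_apply]
    rcases h5 with h5 | h5
    · exact add_pos_of_pos_of_nonneg h5 h3
    · exact add_pos_of_nonneg_of_pos h2 h5.2
  have h2 : μ.real {ω | 0 < W ω} + μ.real ({ω | 0 < W ω}ᶜ ∩ {ω | 0 < V ω}) ≤
      μ.real {ω | 0 < (W + V) ω} := by
    rw [← measureReal_union (Set.disjoint_left.2 fun ω h h' => h'.1 h) (hA.inter (hsm V))]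
    exact ENNReal.toReal_mono (measure_ne_top _ _) (measure_mono_ae h1)
  have h3 : μ.real ({ω | 0 < W ω}ᶜ ∩ {ω | 0 < V ω}) ≤ 0 := by linarith
  refine hV ?_
  have h4 : μ ({ω | 0 < W ω}ᶜ ∩ {ω | 0 < V ω}) = 0 :=
    (measureReal_eq_zero_iff).1 (le_antisymm h3 measureReal_nonneg)
  rw [measure_eq_zero_iff_ae_notMem] at h4
  filter_upwards [h4] with ω h5 h6
  exact not_lt.1 fun h7 => h5 ⟨h6, h7⟩

/-! ### Pricing densities for a single period -/

variable [Fintype ι]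

/-- The square integrable claims that dominate the gain of some position. -/
def superhedgeable (G : MeasurableSpace Ω) {m0 : MeasurableSpace Ω} (μ : Measure Ω)
    (Y : ι → Ω → ℝ) : PointedCone ℝ (Lp ℝ 2 μ) where
  carrier := {f | ∃ u : ι → Ω → ℝ, (∀ i, Measurable[G] (u i)) ∧
    ∀ᵐ ω ∂μ, ∑ i, u i ω * Y i ω ≤ f ω}
  zero_mem' := ⟨fun _ _ => 0, fun _ => measurable_const, by
    filter_upwards [Lp.coeFn_zero ℝ 2 μ] with ω h
    simpa using h.ge⟩
  add_mem' := by
    rintro f g ⟨u, hum, hu⟩ ⟨v, hvm, hv⟩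
    refine ⟨fun i => u i + v i, fun i => (hum i).add (hvm i), ?_⟩
    filter_upwards [hu, hv, Lp.coeFn_add f g] with ω h1 h2 h3
    rw [h3]
    simpa [add_mul, Finset.sum_add_distrib] using add_le_add h1 h2
  smul_mem' := by
    rintro ⟨a, ha⟩ f ⟨u, hum, hu⟩
    refine ⟨fun i ω => a * u i ω, fun i => (hum i).const_mul a, ?_⟩
    filter_upwards [hu, Lp.coeFn_smul a f] with ω h1 h2
    have h3 : ((⟨a, ha⟩ : {r : ℝ // 0 ≤ r}) • f) ω = a * f ω := h2
    rw [h3]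
    simpa [mul_assoc, Finset.mul_sum] using mul_le_mul_of_nonneg_left h1 ha

theorem NoArbitrageStep.exists_density_of_orthogonal (hG : G ≤ m0) {Y : ι → Ω → ℝ}
    (hNA : NoArbitrageStep G μ Y) (hYm : ∀ i, Measurable (Y i)) {c : ℝ} (hYb : ∀ i ω, |Y i ω| ≤ c)
    (horth : ∀ i j, i ≠ j → μ[fun ω => Y i ω * Y j ω | G] =ᵐ[μ] 0) :
    ∃ Z : Lp ℝ 2 μ, (∀ᵐ ω ∂μ, 0 < Z ω) ∧ ∀ i, μ[fun ω => Z ω * Y i ω | G] =ᵐ[μ] 0 := by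
  classical
  let K := superhedgeable G μ Y
  let D : ProperCone ℝ (Lp ℝ 2 μ) := ProperCone.innerDual (K : Set (Lp ℝ 2 μ))
  have hinner : ∀ f g : Lp ℝ 2 μ, inner ℝ f g = ∫ ω, f ω * g ω ∂μ := fun f g => by
    rw [L2.inner_def]
    simp [mul_comm]
  have hnn : ∀ f : Lp ℝ 2 μ, 0 ≤ f → f ∈ K := fun f hf =>
    ⟨fun _ _ => 0, fun _ => measurable_const, by
      filter_upwards [(Lp.coeFn_nonneg _).2 hf] with ω h
      simpa using h⟩
  -- test an element of the dual cone against its own negative part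
  have hD : ∀ Z ∈ D, 0 ≤ Z := by
    intro Z hZ
    have h1 : 0 ≤ inner ℝ ((-Z) ⊔ 0) Z := hZ (hnn _ le_sup_right)
    have h2 : ∀ᵐ ω ∂μ, ((-Z) ⊔ 0 : Lp ℝ 2 μ) ω = max (-Z ω) 0 := by
      filter_upwards [Lp.coeFn_sup (-Z) 0, Lp.coeFn_neg Z, Lp.coeFn_zero ℝ 2 μ] with ω h3 h4 h5
      rw [h3, Pi.sup_apply, h4, h5]
      rfl
    have h3 : inner ℝ ((-Z) ⊔ 0) Z = - inner ℝ ((-Z) ⊔ 0) ((-Z) ⊔ 0) := by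
      rw [hinner, hinner, ← integral_neg]
      refine integral_congr_ae ?_
      filter_upwards [h2] with ω h4
      rw [h4]
      rcases le_total 0 (Z ω) with h | h
      · simp [h]
      · rw [max_eq_left (neg_nonneg.2 h)]
        ring
    rw [h3, real_inner_self_eq_norm_sq] at h1
    have h4 : ((-Z) ⊔ 0 : Lp ℝ 2 μ) = 0 := by
      rw [← norm_eq_zero]
      nlinarith [norm_nonneg ((-Z) ⊔ 0 : Lp ℝ 2 μ)]
    exact neg_nonpos.1 (le_sup_left.trans h4.le)
  have hcharge : ∀ A, MeasurableSet A → μ A ≠ 0 → ∃ Z ∈ D, ¬ ∀ᵐ ω ∂μ, ω ∈ A → Z ω ≤ 0 := by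
    intro A hA hA0
    let b : Lp ℝ 2 μ := indicatorConstLp 2 hA (measure_ne_top μ A) (1 : ℝ)
    have hb : b =ᵐ[μ] A.indicator fun _ => 1 := indicatorConstLp_coeFn
    have hbK : -b ∉ Submodule.closure K := by
      intro hmem
      obtain ⟨f, hfK, hf⟩ := mem_closure_iff_seq_limit.1 (show -b ∈ closure (K : Set _) from hmem)
      obtain ⟨ns, hns, hlim⟩ := (tendstoInMeasure_of_tendsto_Lp hf).exists_seq_tendsto_ae
      choose u hum hu using hfK
      have h1 := hNA.limit_nonpos hG hYm hYb horth (u := fun n i ω => -u (ns n) i ω)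
        (f := fun n ω => -f (ns n) ω) (g := b) (fun n i => (hum (ns n) i).neg)
        (fun n => by
          filter_upwards [hu (ns n)] with ω h
          simpa using h)
        (by
          filter_upwards [hlim, Lp.coeFn_neg b] with ω h h'
          rw [h'] at h
          simpa using h.neg)
        (by
          filter_upwards [hb] with ω h
          rw [h]
          exact Set.indicator_nonneg (fun _ _ => zero_le_one) ω)
      refine hA0 (measure_eq_zero_iff_ae_notMem.2 ?_)
      filter_upwards [h1, hb] with ω h2 h3 h4
      rw [h3, Set.indicator_of_mem h4] at h2
      exact absurd h2 (by norm_num)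
    obtain ⟨Z, hZ, hZb⟩ := ProperCone.hyperplane_separation' _ hbK
    refine ⟨Z, fun x hx => hZ x (subset_closure hx), fun hcon => ?_⟩
    rw [inner_neg_left, neg_lt_zero, hinner] at hZb
    refine not_le.2 hZb (integral_nonpos_of_ae ?_)
    filter_upwards [hcon, hb] with ω h1 h2
    rw [h2]
    by_cases hω : ω ∈ A
    · simpa [hω] using h1 hω
    · simp [hω]
  obtain ⟨Z, hZD, hZ⟩ := exists_mem_properCone_pos D hD hcharge
  refine ⟨Z, hZ, fun i => ?_⟩
  have hZi : Integrable Z μ := (Lp.memLp Z).integrable (by norm_num)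
  have hZY : Integrable (fun ω => Z ω * Y i ω) μ :=
    hZi.mul_bdd (hYm i).aestronglyMeasurable (.of_forall (hYb i))
  have hpos : ∀ A, MeasurableSet[G] A → ∀ a : ℝ, 0 ≤ a * ∫ ω in A, Z ω * Y i ω ∂μ := by
    intro A hA a
    let y : Ω → ℝ := fun ω => A.indicator (fun _ => a) ω * Y i ω
    have hy : MemLp y 2 μ := by
      refine MemLp.of_bound ((measurable_const.indicator (hG A hA)).mul
        (hYm i)).aestronglyMeasurable (|a| * c) (.of_forall fun ω => ?_)
      rw [norm_mul]
      refine mul_le_mul ?_ (hYb i ω) (norm_nonneg _) (abs_nonneg _)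
      exact norm_indicator_le_norm_self (fun _ => a) ω
    have hyK : hy.toLp y ∈ K := by
      refine ⟨fun j => if j = i then A.indicator fun _ => a else fun _ => 0, fun j => ?_, ?_⟩
      · by_cases hj : j = i
        · simp only [hj, if_true]
          exact measurable_const.indicator hA
        · simp only [hj, if_false]
          exact measurable_const
      · filter_upwards [hy.coeFn_toLp] with ω h
        rw [h, Finset.sum_eq_single i (fun j _ hj => by simp [hj])
          (fun h => absurd (Finset.mem_univ i) h)]
        simp [y]
    have h1 : 0 ≤ inner ℝ (hy.toLp y) Z := hZD hyK
    rw [hinner] at h1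
    rw [← integral_const_mul, ← integral_indicator (hG A hA)]
    refine h1.trans (le_of_eq (integral_congr_ae ?_))
    filter_upwards [hy.coeFn_toLp] with ω h
    rw [h]
    by_cases hω : ω ∈ A
    · simp only [y, hω, Set.indicator_of_mem]
      ring
    · simp [y, hω]
  refine (ae_eq_condExp_of_forall_setIntegral_eq hG hZY (fun _ _ _ => integrableOn_zero)
    (fun A hA _ => ?_) aestronglyMeasurable_zero).symm
  have h1 := hpos A hA 1
  have h2 := hpos A hA (-1)
  simp only [integral_zero]
  linarith

/-- The fundamental theorem for a single period with bounded price increments. -/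
theorem NoArbitrageStep.exists_density (hG : G ≤ m0) {X : ι → Ω → ℝ}
    (hNA : NoArbitrageStep G μ X) (hXm : ∀ i, Measurable (X i)) {c : ℝ}
    (hXb : ∀ i ω, |X i ω| ≤ c) :
    ∃ Z : Ω → ℝ, Measurable Z ∧ Integrable Z μ ∧ (∀ ω, 0 < Z ω) ∧
      ∀ i, μ[fun ω => Z ω * X i ω | G] =ᵐ[μ] 0 := by
  obtain ⟨Y, hYm, ⟨K, hYb⟩, horth, hNAY, hXY⟩ := exists_condExp_orthogonal (μ := μ) hG hXm hXb
    Finset.univ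
  obtain ⟨Z, hZ, hZY⟩ := (hNAY hNA).exists_density_of_orthogonal hG hYm hYb
    fun i j => horth i (Finset.mem_univ i) j (Finset.mem_univ j)
  have hZm : Measurable Z := (Lp.stronglyMeasurable Z).measurable
  have hZi : Integrable Z μ := (Lp.memLp Z).integrable (by norm_num)
  -- a version of the density that is positive everywhere
  let W : Ω → ℝ := fun ω => if 0 < Z ω then Z ω else 1
  have hWZ : W =ᵐ[μ] Z := by
    filter_upwards [hZ] with ω h
    exact if_pos h
  refine ⟨W, Measurable.ite (measurableSet_lt measurable_const hZm) hZm measurable_const,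
    hZi.congr hWZ.symm, fun ω => ?_, hXY W (hZi.congr hWZ.symm) fun i => ?_⟩
  · by_cases h : 0 < Z ω
    · simp only [W, h, if_true]
    · simp only [W, h, if_false]
      exact one_pos
  · refine (condExp_congr_ae ?_).trans (hZY i)
    filter_upwards [hWZ] with ω h
    rw [h]

end

section

variable {Ω ι : Type*} {G m0 : MeasurableSpace Ω} {μ : Measure Ω}

/-! ### Conditional expectations of nonnegative functions -/

/-- Integrability of a product of nonnegative functions can be checked after taking the conditional
expectation of one factor, if the other factor is measurable for the smaller σ-algebra. -/
theorem integrable_mul_of_integrable_mul_condExp [IsFiniteMeasure μ] (hG : G ≤ m0) {g h : Ω → ℝ}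
    (hg : Measurable[G] g) (hg0 : 0 ≤ᵐ[μ] g) (hh : Integrable h μ) (hh0 : 0 ≤ᵐ[μ] h)
    (hgh : Integrable (fun ω => g ω * μ[h | G] ω) μ) : Integrable (fun ω => g ω * h ω) μ := by
  -- bounded truncations of `g`, for which the pull-out property holds
  let a : ℕ → Ω → ℝ := fun n ω => max 0 (min (g ω) n)
  have ham : ∀ n, Measurable[G] (a n) := fun n => measurable_const.max (hg.min measurable_const)
  have hab : ∀ n ω, ‖a n ω‖ ≤ n := fun n ω => by
    rw [Real.norm_of_nonneg (le_max_left _ _)]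
    exact max_le n.cast_nonneg (min_le_right _ _)
  have hah : ∀ n, Integrable (a n * h) μ := fun n =>
    hh.bdd_mul ((ham n).mono hG le_rfl).aestronglyMeasurable (.of_forall (hab n))
  have hae : ∀ᵐ ω ∂μ, ∀ n, a n ω ≤ g ω := by
    filter_upwards [hg0] with ω h n using max_le h (min_le_left _ _)
  have hnorm : ∀ n, eLpNorm (a n * h) 1 μ ≤ ENNReal.ofReal (∫ ω, g ω * μ[h | G] ω ∂μ) := by
    intro n
    rw [eLpNorm_one_eq_lintegral_enorm, ← ofReal_integral_norm_eq_lintegral_enorm (hah n)]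
    refine ENNReal.ofReal_le_ofReal ?_
    have h1 : ∫ ω, ‖(a n * h) ω‖ ∂μ = ∫ ω, (a n * h) ω ∂μ := by
      refine integral_congr_ae ?_
      filter_upwards [hh0] with ω h2
      exact Real.norm_of_nonneg (mul_nonneg (le_max_left _ _) h2)
    rw [h1, ← integral_condExp hG]
    refine integral_mono_ae integrable_condExp hgh ?_
    filter_upwards [condExp_stronglyMeasurable_mul_of_bound hG (ham n).stronglyMeasurable hh n
      (.of_forall (hab n)), hae, condExp_nonneg (m := G) hh0] with ω h2 h3 h4
    rw [h2]
    exact mul_le_mul_of_nonneg_right (h3 n) h4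
  have hmeas : AEStronglyMeasurable (fun ω => g ω * h ω) μ :=
    (hg.mono hG le_rfl).aestronglyMeasurable.mul hh.aestronglyMeasurable
  refine memLp_one_iff_integrable.1 ⟨hmeas, lt_of_le_of_lt
    (b := ENNReal.ofReal (∫ ω, g ω * μ[h | G] ω ∂μ)) ?_ ENNReal.ofReal_lt_top⟩
  refine Lp.eLpNorm_le_of_ae_tendsto (u := atTop) (f := fun n => a n * h) (.of_forall hnorm)
    (fun n => (hah n).aestronglyMeasurable) ?_
  filter_upwards [hg0] with ω h1
  refine tendsto_const_nhds.congr' ?_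
  filter_upwards [eventually_ge_atTop ⌈g ω⌉₊] with n hn
  have h2 : a n ω = g ω := by
    simp only [a]
    rw [min_eq_left ((Nat.le_ceil _).trans (by exact_mod_cast hn))]
    exact max_eq_right h1
  rw [Pi.mul_apply, h2]

/-- The pull-out property for nonnegative functions. -/
theorem condExp_mul_of_nonneg [IsFiniteMeasure μ] (hG : G ≤ m0) {g h : Ω → ℝ}
    (hg : Measurable[G] g) (hg0 : 0 ≤ᵐ[μ] g) (hh : Integrable h μ) (hh0 : 0 ≤ᵐ[μ] h)
    (hgh : Integrable (fun ω => g ω * μ[h | G] ω) μ) :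
    μ[fun ω => g ω * h ω | G] =ᵐ[μ] fun ω => g ω * μ[h | G] ω :=
  condExp_mul_of_stronglyMeasurable_left hg.stronglyMeasurable
    (integrable_mul_of_integrable_mul_condExp hG hg hg0 hh hh0 hgh) hh

theorem condExp_pos_of_pos [IsFiniteMeasure μ] (hG : G ≤ m0) {h : Ω → ℝ} (hh : Integrable h μ)
    (hh0 : ∀ ω, 0 < h ω) : ∀ᵐ ω ∂μ, 0 < μ[h | G] ω := by
  have hA : MeasurableSet[G] {ω | μ[h | G] ω ≤ 0} :=
    measurableSet_le stronglyMeasurable_condExp.measurable measurable_const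
  have h1 : ∫ ω in {ω | μ[h | G] ω ≤ 0}, h ω ∂μ ≤ 0 := by
    rw [← setIntegral_condExp hG hh hA]
    exact setIntegral_nonpos (hG _ hA) fun ω hω => hω
  have h2 : ∫ ω in {ω | μ[h | G] ω ≤ 0}, h ω ∂μ = 0 :=
    le_antisymm h1 (setIntegral_nonneg (hG _ hA) fun ω _ => (hh0 ω).le)
  rw [setIntegral_eq_zero_iff_of_nonneg_ae (.of_forall fun ω => (hh0 ω).le) hh.integrableOn] at h2
  filter_upwards [(ae_restrict_iff' (hG _ hA)).1 h2] with ω h3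
  exact not_le.1 fun h4 => (hh0 ω).ne' (h3 h4)

/-! ### Restriction of the measure to a σ-algebra -/

theorem ae_trim_of_ae {F : MeasurableSpace Ω} (hF : F ≤ m0) {p : Ω → Prop}
    (hp : MeasurableSet[F] {ω | p ω}) (h : ∀ᵐ ω ∂μ, p ω) : ∀ᵐ ω ∂(μ.trim hF), p ω := by
  rw [ae_iff] at h ⊢
  exact (trim_measurableSet_eq hF hp.compl).trans h

theorem condExp_eq_zero_of_trim [IsFiniteMeasure μ] {F : MeasurableSpace Ω} (hGF : G ≤ F)
    (hF : F ≤ m0) {f : Ω → ℝ} (hfm : Measurable[F] f) (hf : Integrable f μ)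
    (h : (μ.trim hF)[f | G] =ᵐ[μ.trim hF] 0) : μ[f | G] =ᵐ[μ] 0 := by
  refine (ae_eq_condExp_of_forall_setIntegral_eq (hGF.trans hF) hf (fun _ _ _ => integrableOn_zero)
    (fun A hA _ => ?_) aestronglyMeasurable_zero).symm
  rw [setIntegral_trim hF hfm.stronglyMeasurable (hGF A hA),
    ← setIntegral_condExp hGF (hf.trim hF hfm.stronglyMeasurable) hA]
  rw [setIntegral_congr_ae (g := fun _ => (0 : ℝ)) (hGF A hA)]
  · simp
  · filter_upwards [h] with ω hω _ using hω

theorem noArbitrageStep_trim_iff [Fintype ι] {F : MeasurableSpace Ω} (hGF : G ≤ F) (hF : F ≤ m0)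
    {X : ι → Ω → ℝ} (hX : ∀ i, Measurable[F] (X i)) :
    NoArbitrageStep G (μ.trim hF) X ↔ NoArbitrageStep G μ X := by
  have hm : ∀ θ : ι → Ω → ℝ, (∀ i, Measurable[G] (θ i)) →
      Measurable[F] fun ω => ∑ i, θ i ω * X i ω := fun θ hθ =>
    Finset.measurable_fun_sum _ fun i _ => ((hθ i).mono hGF le_rfl).mul (hX i)
  constructor
  · intro h θ hθ h0
    exact ae_of_ae_trim hF (h θ hθ (ae_trim_of_ae hF
      (measurableSet_le measurable_const (hm θ hθ)) h0))
  · intro h θ hθ h0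
    exact ae_trim_of_ae hF (hm θ hθ (measurableSet_singleton 0)) (h θ hθ (ae_of_ae_trim hF h0))

/-! ### Martingale deflators for several periods -/

/-- A density for a single period whose price increments need not be bounded: the increments are
divided by the size of the prices, which also makes the deflated prices integrable. -/
theorem NoArbitrageStep.exists_density_of_sub [Fintype ι] [IsFiniteMeasure μ]
    {F : MeasurableSpace Ω} (hGF : G ≤ F) (hF : F ≤ m0) {U V : ι → Ω → ℝ}
    (hU : ∀ i, Measurable[G] (U i)) (hV : ∀ i, Measurable[F] (V i))
    (hNA : NoArbitrageStep G μ fun i ω => V i ω - U i ω) :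
    ∃ Z : Ω → ℝ, Measurable[F] Z ∧ (∀ ω, 0 < Z ω) ∧ Integrable Z μ ∧
      ∀ i, Integrable (fun ω => Z ω * U i ω) μ ∧ Integrable (fun ω => Z ω * V i ω) μ ∧
        μ[fun ω => Z ω * V i ω | G] =ᵐ[μ] μ[fun ω => Z ω * U i ω | G] := by
  have hU' : ∀ i, Measurable[F] (U i) := fun i => (hU i).mono hGF le_rfl
  let r : Ω → ℝ := fun ω => 1 + ∑ i, (|U i ω| + |V i ω|)
  have hri : ∀ i ω, |U i ω| + |V i ω| ≤ r ω := fun i ω =>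
    (Finset.single_le_sum (f := fun i => |U i ω| + |V i ω|)
      (fun _ _ => add_nonneg (abs_nonneg _) (abs_nonneg _)) (Finset.mem_univ i)).trans
      (le_add_of_nonneg_left zero_le_one)
  have hr1 : ∀ ω, 1 ≤ r ω := fun ω => le_add_of_nonneg_right
    (Finset.sum_nonneg fun _ _ => add_nonneg (abs_nonneg _) (abs_nonneg _))
  have hr0 : ∀ ω, 0 < r ω := fun ω => zero_lt_one.trans_le (hr1 ω)
  have hrm : Measurable[F] r := measurable_const.add (Finset.measurable_fun_sum _ fun i _ =>
    (measurable_norm.comp (hU' i)).add (measurable_norm.comp (hV i)))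
  let X : ι → Ω → ℝ := fun i ω => (V i ω - U i ω) / r ω
  have hXm : ∀ i, Measurable[F] (X i) := fun i => ((hV i).sub (hU' i)).div hrm
  have hXb : ∀ i ω, |X i ω| ≤ 1 := fun i ω => by
    rw [abs_div, abs_of_pos (hr0 ω)]
    refine div_le_one_of_le₀ ?_ (hr0 ω).le
    exact (abs_sub _ _).trans ((add_comm _ _).trans_le (hri i ω))
  have hXNA : NoArbitrageStep G μ X := by
    intro θ hθ h
    have h1 : ∀ ω, ∑ i, θ i ω * X i ω = (∑ i, θ i ω * (V i ω - U i ω)) / r ω := fun ω => by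
      rw [Finset.sum_div]
      exact Finset.sum_congr rfl fun i _ => (mul_div_assoc _ _ _).symm
    simp only [h1] at h ⊢
    filter_upwards [hNA θ hθ (by
      filter_upwards [h] with ω h2
      simpa using (le_div_iff₀ (hr0 ω)).1 h2)] with ω h3
    rw [h3, zero_div]
  obtain ⟨Z, hZm, hZi, hZ0, hZX⟩ := NoArbitrageStep.exists_density (m0 := F) (μ := μ.trim hF) hGF
    ((noArbitrageStep_trim_iff hGF hF hXm).2 hXNA) hXm hXb
  have hZi' : Integrable Z μ := integrable_of_integrable_trim hF hZi
  have hquot : ∀ f : Ω → ℝ, Measurable[F] f → (∀ ω, |f ω| ≤ r ω) →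
      Integrable (fun ω => Z ω / r ω * f ω) μ := by
    intro f hf hfr
    refine hZi'.mono (((hZm.div hrm).mul hf).mono hF le_rfl).aestronglyMeasurable
      (.of_forall fun ω => ?_)
    rw [div_mul_eq_mul_div, mul_div_assoc, norm_mul]
    refine mul_le_of_le_one_right (norm_nonneg _) ?_
    rw [norm_div, Real.norm_of_nonneg (hr0 ω).le]
    exact div_le_one_of_le₀ (hfr ω) (hr0 ω).le
  have hintU : ∀ i, Integrable (fun ω => Z ω / r ω * U i ω) μ := fun i => hquot _ (hU' i)
    fun ω => (le_add_of_nonneg_right (abs_nonneg _)).trans (hri i ω)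
  have hintV : ∀ i, Integrable (fun ω => Z ω / r ω * V i ω) μ := fun i => hquot _ (hV i)
    fun ω => (le_add_of_nonneg_left (abs_nonneg _)).trans (hri i ω)
  refine ⟨fun ω => Z ω / r ω, hZm.div hrm, fun ω => div_pos (hZ0 ω) (hr0 ω), ?_,
    fun i => ⟨hintU i, hintV i, ?_⟩⟩
  · simpa using hquot (fun _ => 1) measurable_const fun ω => by simpa using hr1 ω
  · have h1 : (fun ω => Z ω / r ω * V i ω) - (fun ω => Z ω / r ω * U i ω) =
        fun ω => Z ω * X i ω := by
      ext ω
      simp only [X, Pi.sub_apply]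
      ring
    have h2 := condExp_sub (hintV i) (hintU i) G
    rw [h1] at h2
    have h3 : μ[fun ω => Z ω * X i ω | G] =ᵐ[μ] 0 :=
      condExp_eq_zero_of_trim hGF hF (hZm.mul (hXm i)) (h1 ▸ (hintV i).sub (hintU i)) (hZX i)
    filter_upwards [h2, h3] with ω h4 h5
    rw [h4] at h5
    exact sub_eq_zero.1 h5

variable {T : ℕ}

theorem martingale_of_condExp_succ_eq [IsFiniteMeasure μ] {ℱ : Filtration (Fin (T + 1)) m0}
    {f : Fin (T + 1) → Ω → ℝ} (hf : ∀ t, Measurable[ℱ t] (f t)) (hint : ∀ t, Integrable (f t) μ)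
    (h : ∀ k : Fin T, μ[f k.succ | ℱ k.castSucc] =ᵐ[μ] f k.castSucc) : Martingale f ℱ μ := by
  refine ⟨fun t => (hf t).stronglyMeasurable, fun i j => ?_⟩
  have hself : ∀ t, μ[f t | ℱ t] =ᵐ[μ] f t := fun t => by
    rw [condExp_of_stronglyMeasurable (ℱ.le t) (hf t).stronglyMeasurable (hint t)]
  induction j using Fin.induction with
  | zero =>
    intro hi
    rw [Fin.le_zero_iff.1 hi]
    exact hself 0
  | succ k ih =>
    intro hi
    rcases hi.eq_or_lt with rfl | hlt
    · exact hself _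
    · have hi' : i ≤ k.castSucc := Fin.le_castSucc_iff.2 hlt
      exact ((condExp_condExp_of_le (ℱ.mono hi') (ℱ.le _)).symm.trans
        (condExp_congr_ae (h k))).trans (ih hi')

theorem filter_succ_le_succ (k : Fin T) :
    (Finset.univ.filter fun j : Fin T => j.succ ≤ k.succ) =
      insert k (Finset.univ.filter fun j : Fin T => j.succ ≤ k.castSucc) := by
  ext j
  simp only [Finset.mem_filter, Finset.mem_univ, true_and, Finset.mem_insert, Fin.le_def,
    Fin.ext_iff, Fin.val_succ, Fin.val_castSucc]
  omega

theorem notMem_filter_succ_le_castSucc (k : Fin T) :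
    k ∉ Finset.univ.filter fun j : Fin T => j.succ ≤ k.castSucc := by
  simp [Fin.le_def]

/-- The product of the densities `Z k` of the single periods, each normalized to have conditional
expectation one. -/
noncomputable def densityProcess (ℱ : Filtration (Fin (T + 1)) m0) (μ : Measure Ω)
    (Z : Fin T → Ω → ℝ) : Fin (T + 1) → Ω → ℝ :=
  fun t ω => ∏ k : Fin T with k.succ ≤ t, Z k ω / μ[Z k | ℱ k.castSucc] ω

theorem densityProcess_zero (ℱ : Filtration (Fin (T + 1)) m0) (μ : Measure Ω)
    (Z : Fin T → Ω → ℝ) (ω : Ω) : densityProcess ℱ μ Z 0 ω = 1 := by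
  simp [densityProcess, Fin.succ_ne_zero]

theorem densityProcess_succ (ℱ : Filtration (Fin (T + 1)) m0) (μ : Measure Ω)
    (Z : Fin T → Ω → ℝ) (k : Fin T) (ω : Ω) :
    densityProcess ℱ μ Z k.succ ω =
      densityProcess ℱ μ Z k.castSucc ω * (Z k ω / μ[Z k | ℱ k.castSucc] ω) := by
  rw [densityProcess, filter_succ_le_succ, Finset.prod_insert (notMem_filter_succ_le_castSucc k),
    mul_comm]
  rfl

theorem measurable_densityProcess {ℱ : Filtration (Fin (T + 1)) m0} {Z : Fin T → Ω → ℝ}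
    (hZm : ∀ k, Measurable[ℱ k.succ] (Z k)) (t : Fin (T + 1)) :
    Measurable[ℱ t] (densityProcess ℱ μ Z t) := by
  refine Finset.measurable_fun_prod _ fun k hk => ?_
  have hkt : k.succ ≤ t := (Finset.mem_filter.1 hk).2
  refine Measurable.div ((hZm k).mono (ℱ.mono hkt) le_rfl) ?_
  exact (stronglyMeasurable_condExp.measurable).mono
    (ℱ.mono (k.castSucc_lt_succ.le.trans hkt)) le_rfl

variable [IsFiniteMeasure μ] {ℱ : Filtration (Fin (T + 1)) m0} {Z : Fin T → Ω → ℝ}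

theorem densityProcess_pos (hZ0 : ∀ k ω, 0 < Z k ω) (hZi : ∀ k, Integrable (Z k) μ)
    (t : Fin (T + 1)) : ∀ᵐ ω ∂μ, 0 < densityProcess ℱ μ Z t ω := by
  have h : ∀ᵐ ω ∂μ, ∀ k, 0 < μ[Z k | ℱ k.castSucc] ω :=
    ae_all_iff.2 fun k => condExp_pos_of_pos (ℱ.le _) (hZi k) (hZ0 k)
  filter_upwards [h] with ω hω
  exact Finset.prod_pos fun k _ => div_pos (hZ0 k ω) (hω k)

/-- A nonnegative process that is deflated to a martingale over every single period is deflated to a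
martingale by the product of the normalized densities. Nonnegativity provides integrability. -/
theorem martingale_mul_densityProcess (hZm : ∀ k, Measurable[ℱ k.succ] (Z k))
    (hZ0 : ∀ k ω, 0 < Z k ω) (hZi : ∀ k, Integrable (Z k) μ) {f : Fin (T + 1) → Ω → ℝ}
    (hf : ∀ t, Measurable[ℱ t] (f t)) (hf0 : ∀ t, 0 ≤ᵐ[μ] f t) (hfi : Integrable (f 0) μ)
    (hZf : ∀ k, Integrable (fun ω => Z k ω * f k.castSucc ω) μ)
    (hZf' : ∀ k, Integrable (fun ω => Z k ω * f k.succ ω) μ)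
    (h : ∀ k : Fin T, μ[fun ω => Z k ω * f k.succ ω | ℱ k.castSucc] =ᵐ[μ]
      μ[fun ω => Z k ω * f k.castSucc ω | ℱ k.castSucc]) :
    Martingale (fun t ω => f t ω * densityProcess ℱ μ Z t ω) ℱ μ := by
  set D := densityProcess ℱ μ Z with hD
  have hDm : ∀ t, Measurable[ℱ t] (D t) := measurable_densityProcess hZm
  have hD0 : ∀ t, ∀ᵐ ω ∂μ, 0 < D t ω := densityProcess_pos hZ0 hZi
  let g : Fin T → Ω → ℝ := fun k ω => D k.castSucc ω / μ[Z k | ℱ k.castSucc] ω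
  have hgm : ∀ k, Measurable[ℱ k.castSucc] (g k) := fun k =>
    (hDm _).div stronglyMeasurable_condExp.measurable
  have hcZ : ∀ k, ∀ᵐ ω ∂μ, 0 < μ[Z k | ℱ k.castSucc] ω := fun k =>
    condExp_pos_of_pos (ℱ.le _) (hZi k) (hZ0 k)
  have hg0 : ∀ k, 0 ≤ᵐ[μ] g k := fun k => by
    filter_upwards [hcZ k, hD0 k.castSucc] with ω h1 h2 using (div_pos h2 h1).le
  have hstep : ∀ k ω, f k.succ ω * D k.succ ω = g k ω * (Z k ω * f k.succ ω) := fun k ω => by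
    rw [hD, densityProcess_succ]
    simp only [g, ← hD]
    ring
  have hZf0 : ∀ k, 0 ≤ᵐ[μ] fun ω => Z k ω * f k.succ ω := fun k => by
    filter_upwards [hf0 k.succ] with ω h1 using mul_nonneg (hZ0 k ω).le h1
  have hcond : ∀ k, (fun ω => g k ω * μ[fun ω => Z k ω * f k.succ ω | ℱ k.castSucc] ω) =ᵐ[μ]
      fun ω => f k.castSucc ω * D k.castSucc ω := by
    intro k
    have h1 : μ[fun ω => Z k ω * f k.castSucc ω | ℱ k.castSucc] =ᵐ[μ]
        μ[Z k | ℱ k.castSucc] * f k.castSucc :=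
      condExp_mul_of_stronglyMeasurable_right (hf _).stronglyMeasurable (hZf k) (hZi k)
    filter_upwards [h k, h1, hcZ k] with ω h2 h3 h4
    rw [h2, h3, Pi.mul_apply]
    simp only [g]
    field_simp
  have hint : ∀ t, Integrable (fun ω => f t ω * D t ω) μ := by
    intro t
    induction t using Fin.induction with
    | zero => simpa only [hD, densityProcess_zero, mul_one] using hfi
    | succ k ih =>
      simp only [hstep]
      exact integrable_mul_of_integrable_mul_condExp (ℱ.le _) (hgm k) (hg0 k) (hZf' k) (hZf0 k)
        (ih.congr (hcond k).symm)
  refine martingale_of_condExp_succ_eq (fun t => (hf t).mul (hDm t)) hint fun k => ?_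
  simp only [hstep]
  exact (condExp_mul_of_nonneg (ℱ.le _) (hgm k) (hg0 k) (hZf' k) (hZf0 k)
    ((hint _).congr (hcond k).symm)).trans (hcond k)

/-- Absence of arbitrage in every period yields a positive martingale that deflates all prices to
martingales. -/
theorem exists_martingale_deflator [Fintype ι] {X : ι → Fin (T + 1) → Ω → ℝ}
    (hX : ∀ i t, Measurable[ℱ t] (X i t)) (hX0 : ∀ i t, 0 ≤ᵐ[μ] X i t)
    (hXi : ∀ i, Integrable (X i 0) μ)
    (hNA : ∀ k : Fin T, NoArbitrageStep (ℱ k.castSucc) μ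
      fun i ω => X i k.succ ω - X i k.castSucc ω) :
    ∃ D : Fin (T + 1) → Ω → ℝ, Martingale D ℱ μ ∧ (∀ t, ∀ᵐ ω ∂μ, 0 < D t ω) ∧
      ∀ i, Martingale (fun t ω => X i t ω * D t ω) ℱ μ := by
  choose Z hZm hZ0 hZi hZX using fun k : Fin T => (hNA k).exists_density_of_sub
    (ℱ.mono k.castSucc_lt_succ.le) (ℱ.le k.succ) (fun i => hX i _) (fun i => hX i _)
  refine ⟨densityProcess ℱ μ Z, ?_, densityProcess_pos hZ0 hZi, fun i => ?_⟩
  · have h := martingale_mul_densityProcess (f := fun _ _ => 1) hZm hZ0 hZi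
      (fun _ => measurable_const) (fun _ => .of_forall fun _ => zero_le_one)
      (integrable_const 1) (by simpa using hZi) (by simpa using hZi) fun k => .rfl
    simpa only [one_mul] using h
  · exact martingale_mul_densityProcess hZm hZ0 hZi (hX i) (hX0 i) (hXi i)
      (fun k => (hZX k i).1) (fun k => (hZX k i).2.1) fun k => (hZX k i).2.2

end

section

variable {Ω ι : Type*} {m : MeasurableSpace Ω} {T : ℕ}
  {ℱ : Filtration (Fin (T + 1)) m} {P : Measure Ω}

/-! ### Terminal values as classes of random variables -/

theorem ae_coe_zero_L0 : ∀ᵐ ω ∂P, (0 : L0 ℱ P) ω = 0 :=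
  ae_of_ae_trim (ℱ.le _) (@AEEqFun.coeFn_zero Ω ℝ (ℱ (Fin.last T)) (terminalMeasure ℱ P) _ _)

theorem measurable_coe_L0 (ξ : L0 ℱ P) : Measurable[ℱ (Fin.last T)] ξ :=
  (@AEEqFun.stronglyMeasurable Ω ℝ (ℱ (Fin.last T)) _ _ ξ).measurable

theorem exists_L0_ae_eq {f : Ω → ℝ} (hf : Measurable[ℱ (Fin.last T)] f) :
    ∃ ξ : L0 ℱ P, ∀ᵐ ω ∂P, ξ ω = f ω :=
  ⟨_, ae_of_ae_trim (ℱ.le _) (@AEEqFun.coeFn_mk Ω ℝ (ℱ (Fin.last T)) (terminalMeasure ℱ P) _ f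
    hf.stronglyMeasurable.aestronglyMeasurable)⟩

theorem L0_nonneg_iff (ξ : L0 ℱ P) : 0 ≤ ξ ↔ ∀ᵐ ω ∂P, 0 ≤ ξ ω := by
  have h1 := @AEEqFun.coeFn_le Ω ℝ (ℱ (Fin.last T)) (terminalMeasure ℱ P) _ _ 0 ξ
  have h2 := @AEEqFun.coeFn_zero Ω ℝ (ℱ (Fin.last T)) (terminalMeasure ℱ P) _ _
  rw [← h1]
  constructor
  · intro h
    filter_upwards [ae_of_ae_trim (ℱ.le _) h, ae_coe_zero_L0 (ℱ := ℱ) (P := P)] with ω h3 h4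
    exact h4.symm.le.trans h3
  · intro h
    filter_upwards [h2, ae_trim_of_ae (ℱ.le _)
      (measurableSet_le measurable_const (measurable_coe_L0 ξ)) h] with ω h3 h4
    exact h3.le.trans h4

theorem L0_eq_zero_iff (ξ : L0 ℱ P) : ξ = 0 ↔ ∀ᵐ ω ∂P, ξ ω = 0 := by
  constructor
  · rintro rfl
    exact ae_coe_zero_L0
  · intro h
    refine @AEEqFun.ext Ω ℝ (ℱ (Fin.last T)) (terminalMeasure ℱ P) _ ξ 0 ?_
    filter_upwards [@AEEqFun.coeFn_zero Ω ℝ (ℱ (Fin.last T)) (terminalMeasure ℱ P) _ _,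
      ae_trim_of_ae (ℱ.le _) (measurable_coe_L0 ξ (measurableSet_singleton 0)) h] with ω h1 h2
    exact h2.trans h1.symm

/-! ### Self-financing strategies -/

theorem IsSavingsAccount.measurable {B : Fin (T + 1) → Ω → ℝ} (hB : IsSavingsAccount ℱ P B)
    (t : Fin (T + 1)) : Measurable[ℱ t] (B t) := by
  have h := (isStronglyPredictable_iff ℱ B).1 hB.predictable
  induction t using Fin.cases with
  | zero => exact h.1
  | succ k => exact (h.2 k).mono (ℱ.mono k.castSucc_lt_succ.le) le_rfl

theorem measurable_adjoin {S : ι → Fin (T + 1) → Ω → ℝ} (hS : ∀ i t, Measurable[ℱ t] (S i t))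
    {B : Fin (T + 1) → Ω → ℝ} (hB : IsSavingsAccount ℱ P B) (i : Option ι) (t : Fin (T + 1)) :
    Measurable[ℱ t] (adjoin S B i t) := by
  cases i with
  | none => exact hB.measurable t
  | some i => exact hS i t

theorem measurable_mulMarket_inv {S : ι → Fin (T + 1) → Ω → ℝ}
    (hS : ∀ i t, Measurable[ℱ t] (S i t)) {B : Fin (T + 1) → Ω → ℝ}
    (hB : IsSavingsAccount ℱ P B) (i : ι) (t : Fin (T + 1)) :
    Measurable[ℱ t] (mulMarket S (fun t ω => (B t ω)⁻¹) i t) :=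
  (hS i t).mul (hB.measurable t).inv

variable [Fintype ι]

theorem stochIntegral_zero (δ S : ι → Fin (T + 1) → Ω → ℝ) (ω : Ω) :
    stochIntegral δ S 0 ω = 0 := by
  simp [stochIntegral, Fin.succ_ne_zero]

theorem stochIntegral_succ (δ S : ι → Fin (T + 1) → Ω → ℝ) (k : Fin T) (ω : Ω) :
    stochIntegral δ S k.succ ω = stochIntegral δ S k.castSucc ω +
      ∑ i, δ i k.succ ω * (S i k.succ ω - S i k.castSucc ω) := by
  rw [stochIntegral, filter_succ_le_succ, Finset.sum_insert (notMem_filter_succ_le_castSucc k),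
    add_comm]
  rfl

/-- A strategy is self-financing if and only if rebalancing at the beginning of each period does not
change the value of the portfolio. -/
theorem isSelfFinancing_iff {S δ : ι → Fin (T + 1) → Ω → ℝ} :
    IsSelfFinancing ℱ P S δ ↔ IsStrategy ℱ δ ∧
      ∀ k : Fin T, ∀ᵐ ω ∂P, ∑ i, δ i k.succ ω * S i k.castSucc ω = portfolio S δ k.castSucc ω := by
  have hsplit : ∀ (k : Fin T) ω, ∑ i, δ i k.succ ω * (S i k.succ ω - S i k.castSucc ω) =
      portfolio S δ k.succ ω - ∑ i, δ i k.succ ω * S i k.castSucc ω := fun k ω => by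
    simp only [portfolio, mul_sub, Finset.sum_sub_distrib]
  refine and_congr_right fun _ => ⟨fun h k => ?_, fun h t => ?_⟩
  · filter_upwards [h k.succ, h k.castSucc] with ω h1 h2
    rw [stochIntegral_succ, hsplit] at h1
    linarith
  · induction t using Fin.induction with
    | zero => exact .of_forall fun ω => by rw [stochIntegral_zero, add_zero]
    | succ k ih =>
      filter_upwards [ih, h k] with ω h1 h2
      rw [stochIntegral_succ, hsplit, h2]
      linarith

theorem measurable_portfolio {S δ : ι → Fin (T + 1) → Ω → ℝ} (hS : ∀ i t, Measurable[ℱ t] (S i t))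
    (hδ : IsStrategy ℱ δ) (t : Fin (T + 1)) : Measurable[ℱ t] (portfolio S δ t) := by
  refine Finset.measurable_fun_sum _ fun i _ => Measurable.mul ?_ (hS i t)
  have h := (isStronglyPredictable_iff ℱ (δ i)).1 (hδ i)
  induction t using Fin.cases with
  | zero => exact h.1
  | succ k => exact (h.2 k).mono (ℱ.mono k.castSucc_lt_succ.le) le_rfl

/-! ### Arbitrage over several periods and over a single period -/

/-- An arbitrage over the period that follows time `k` extends to the whole time interval: the gain
is kept in the savings account. -/
theorem NA.noArbitrageStep {S : ι → Fin (T + 1) → Ω → ℝ} (hS : ∀ i t, Measurable[ℱ t] (S i t))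
    {B : Fin (T + 1) → Ω → ℝ} (hB : IsSavingsAccount ℱ P B)
    (hNA : NA (sfOutcomes ℱ P (adjoin S B) 0)) (k : Fin T) :
    NoArbitrageStep (ℱ k.castSucc) P fun i ω =>
      mulMarket S (fun t ω => (B t ω)⁻¹) i k.succ ω -
        mulMarket S (fun t ω => (B t ω)⁻¹) i k.castSucc ω := by
  intro θ hθ hθ0
  set X := mulMarket S (fun t ω => (B t ω)⁻¹)
  have hX : ∀ i t, Measurable[ℱ t] (X i t) := measurable_mulMarket_inv hS hB
  have hkk : ℱ k.castSucc ≤ ℱ k.succ := ℱ.mono k.castSucc_lt_succ.le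
  have hB0 : ∀ᵐ ω ∂P, ∀ t, 0 < B t ω := ae_all_iff.2 hB.pos
  -- the discounted gain, and the loan from the savings account that finances the position
  let W : Ω → ℝ := fun ω => ∑ i, θ i ω * (X i k.succ ω - X i k.castSucc ω)
  have hW : Measurable[ℱ k.succ] W := Finset.measurable_fun_sum _ fun i _ =>
    ((hθ i).mono hkk le_rfl).mul ((hX i _).sub ((hX i _).mono hkk le_rfl))
  let debt : Ω → ℝ := fun ω => -∑ i, θ i ω * X i k.castSucc ω
  have hdebt : Measurable[ℱ k.castSucc] debt :=
    (Finset.measurable_fun_sum _ fun i _ => (hθ i).mul (hX i _)).neg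
  let δ : Option ι → Fin (T + 1) → Ω → ℝ
    | none => fun t => if t = k.succ then debt else if k.succ < t then W else 0
    | some i => fun t => if t = k.succ then θ i else 0
  have hδ : IsStrategy ℱ δ := by
    intro i
    rw [isStronglyPredictable_iff]
    have h0 : ¬ (0 : Fin (T + 1)) = k.succ := (Fin.succ_ne_zero k).symm
    cases i with
    | none =>
      refine ⟨?_, fun j => ?_⟩
      · simp only [δ, h0, Fin.not_lt_zero, if_false]
        exact measurable_const
      · simp only [δ]
        by_cases hj : j = k
        · subst hj
          simpa only [if_true] using hdebt
        · have hj' : ¬ j.succ = k.succ := fun h => hj (Fin.succ_injective _ h)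
          by_cases hlt : k.succ < j.succ
          · simp only [hj', hlt, if_false, if_true]
            exact hW.mono (ℱ.mono (Fin.le_castSucc_iff.2 hlt)) le_rfl
          · simp only [hj', hlt, if_false]
            exact measurable_const
    | some i =>
      refine ⟨?_, fun j => ?_⟩
      · simp only [δ, h0, if_false]
        exact measurable_const
      · simp only [δ]
        by_cases hj : j = k
        · subst hj
          simpa only [if_true] using hθ i
        · have hj' : ¬ j.succ = k.succ := fun h => hj (Fin.succ_injective _ h)
          simp only [hj', if_false]
          exact measurable_const
  have hV : ∀ᵐ ω ∂P, ∀ t, portfolio (adjoin S B) δ t ω = if k.succ ≤ t then W ω * B t ω else 0 := by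
    filter_upwards [hB0] with ω h t
    have hXB : ∀ i t, X i t ω * B t ω = S i t ω := fun i t => by
      simp only [X, mulMarket]
      rw [mul_assoc, inv_mul_cancel₀ (h t).ne', mul_one]
    simp only [portfolio, Fintype.sum_option, δ, adjoin]
    by_cases h1 : t = k.succ
    · subst h1
      simp only [if_true, le_refl, W, debt, Finset.sum_mul, neg_mul, mul_sub, sub_mul,
        Finset.sum_sub_distrib, mul_assoc, hXB]
      ring
    · by_cases h2 : k.succ < t
      · simp [h1, h2, h2.le]
      · have h3 : ¬ k.succ ≤ t := fun h3 => h2 (lt_of_le_of_ne h3 (Ne.symm h1))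
        simp [h1, h2, h3]
  have hsf : IsSelfFinancing ℱ P (adjoin S B) δ := by
    refine isSelfFinancing_iff.2 ⟨hδ, fun j => ?_⟩
    filter_upwards [hV, hB0] with ω h h0
    rw [h]
    have hXB : ∀ i t, X i t ω * B t ω = S i t ω := fun i t => by
      simp only [X, mulMarket]
      rw [mul_assoc, inv_mul_cancel₀ (h0 t).ne', mul_one]
    simp only [Fintype.sum_option, δ, adjoin]
    by_cases h1 : j = k
    · subst h1
      have h2 : ¬ j.succ ≤ j.castSucc := not_le.2 j.castSucc_lt_succ
      simp only [if_true, h2, if_false, debt, neg_mul, Finset.sum_mul, mul_assoc, hXB]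
      ring
    · have h1' : ¬ j.succ = k.succ := fun h => h1 (Fin.succ_injective _ h)
      by_cases h2 : k.succ < j.succ
      · simp [h1, h2, Fin.le_castSucc_iff]
      · simp [h1, h2, Fin.le_castSucc_iff]
  have hVm : Measurable[ℱ (Fin.last T)] (portfolio (adjoin S B) δ (Fin.last T)) :=
    measurable_portfolio (measurable_adjoin hS hB) hδ _
  obtain ⟨ξ, hξ⟩ := exists_L0_ae_eq (P := P) hVm
  have hξmem : ξ ∈ sfOutcomes ℱ P (adjoin S B) 0 := by
    refine ⟨δ, hsf, ?_, hξ⟩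
    filter_upwards [hV] with ω h
    rw [h, if_neg]
    exact fun h => Fin.succ_ne_zero k (Fin.le_zero_iff.1 h)
  have hξ0 : 0 ≤ ξ := by
    rw [L0_nonneg_iff]
    filter_upwards [hξ, hV, hθ0, hB0] with ω h1 h2 h3 h4
    rw [h1, h2, if_pos (Fin.le_last _)]
    exact mul_nonneg h3 (h4 _).le
  have hξeq : ξ ∈ ({0} : Set (L0 ℱ P)) := hNA ▸ ⟨hξmem, hξ0⟩
  have hzero := (L0_eq_zero_iff ξ).1 hξeq
  filter_upwards [hξ, hzero, hV, hB0] with ω h1 h2 h3 h4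
  rw [h2, h3, if_pos (Fin.le_last _)] at h1
  exact (mul_eq_zero.1 h1.symm).resolve_right (h4 _).ne'

/-- If there is no arbitrage in any single period, then a portfolio with nonnegative terminal value
has nonnegative value at all times. If it starts at zero, it therefore stays at zero. -/
theorem NA_of_noArbitrageStep {S : ι → Fin (T + 1) → Ω → ℝ}
    (hS : ∀ i t, Measurable[ℱ t] (S i t)) {B : Fin (T + 1) → Ω → ℝ}
    (hB : IsSavingsAccount ℱ P B)
    (hNA : ∀ k : Fin T, NoArbitrageStep (ℱ k.castSucc) P fun i ω =>
      mulMarket S (fun t ω => (B t ω)⁻¹) i k.succ ω -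
        mulMarket S (fun t ω => (B t ω)⁻¹) i k.castSucc ω) :
    NA (sfOutcomes ℱ P (adjoin S B) 0) := by
  refine Set.eq_singleton_iff_unique_mem.2
    ⟨⟨⟨fun _ _ _ => 0, ?_, ?_, ?_⟩, le_refl (0 : L0 ℱ P)⟩, ?_⟩
  · refine isSelfFinancing_iff.2 ⟨fun i => ?_, fun k => .of_forall fun ω => by simp [portfolio]⟩
    exact (isStronglyPredictable_iff ℱ _).2 ⟨measurable_const, fun _ => measurable_const⟩
  · exact .of_forall fun ω => by simp [portfolio]
  · filter_upwards [ae_coe_zero_L0 (ℱ := ℱ) (P := P)] with ω h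
    simp [h, portfolio]
  rintro ξ ⟨⟨δ, hδ, hδ0, hξ⟩, hξ0⟩
  rw [isSelfFinancing_iff] at hδ
  obtain ⟨hstrat, hsf⟩ := hδ
  set X := mulMarket S (fun t ω => (B t ω)⁻¹)
  have hB0 : ∀ᵐ ω ∂P, ∀ t, 0 < B t ω := ae_all_iff.2 hB.pos
  let V : Fin (T + 1) → Ω → ℝ := fun t ω => portfolio (adjoin S B) δ t ω * (B t ω)⁻¹
  have hVm : ∀ t, Measurable[ℱ t] (V t) := fun t =>
    (measurable_portfolio (measurable_adjoin hS hB) hstrat t).mul (hB.measurable t).inv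
  let θ : Fin T → ι → Ω → ℝ := fun k i => δ (some i) k.succ
  have hθ : ∀ k i, Measurable[ℱ k.castSucc] (θ k i) := fun k i =>
    ((isStronglyPredictable_iff ℱ _).1 (hstrat (some i))).2 k
  -- discounting removes the savings account from the gains
  have hgain : ∀ k : Fin T, ∀ᵐ ω ∂P,
      ∑ i, θ k i ω * (X i k.succ ω - X i k.castSucc ω) = V k.succ ω - V k.castSucc ω := by
    intro k
    filter_upwards [hsf k, hB0] with ω h1 h2
    have h3 := (h2 k.castSucc).ne'
    have h4 := (h2 k.succ).ne'
    simp only [V]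
    rw [← h1]
    simp only [portfolio, Fintype.sum_option, adjoin, X, mulMarket, θ, add_mul,
      Finset.sum_mul, mul_sub, Finset.sum_sub_distrib, ← mul_assoc, mul_inv_cancel_right₀ h3,
      mul_inv_cancel_right₀ h4]
    ring
  have hξT : ∀ᵐ ω ∂P, 0 ≤ V (Fin.last T) ω := by
    filter_upwards [(L0_nonneg_iff ξ).1 hξ0, hξ, hB0] with ω h1 h2 h3
    rw [h2] at h1
    exact mul_nonneg h1 (inv_pos.2 (h3 _)).le
  have hVnn : ∀ t, ∀ᵐ ω ∂P, 0 ≤ V t ω := by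
    intro t
    induction t using Fin.reverseInduction with
    | last => exact hξT
    | cast k ih =>
      -- trade only where the portfolio has negative value
      have hA : MeasurableSet[ℱ k.castSucc] {ω | V k.castSucc ω < 0} :=
        measurableSet_lt (hVm _) measurable_const
      have hsum : ∀ᵐ ω ∂P, ∑ i, {ω | V k.castSucc ω < 0}.indicator (θ k i) ω *
          (X i k.succ ω - X i k.castSucc ω) =
          {ω | V k.castSucc ω < 0}.indicator (fun ω => V k.succ ω - V k.castSucc ω) ω := by
        filter_upwards [hgain k] with ω h
        by_cases hω : V k.castSucc ω < 0
        · simpa [Set.indicator, hω] using h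
        · simp [Set.indicator, hω]
      have h0 := hNA k (fun i => {ω | V k.castSucc ω < 0}.indicator (θ k i))
        (fun i => (hθ k i).indicator hA) (by
          filter_upwards [hsum, ih] with ω h1 h2
          rw [h1]
          refine Set.indicator_apply_nonneg fun hω => ?_
          exact sub_nonneg.2 ((le_of_lt hω).trans h2))
      filter_upwards [h0, hsum, ih] with ω h1 h2 h3
      by_contra hω
      rw [not_le] at hω
      rw [h2, Set.indicator_of_mem (show ω ∈ {ω | V k.castSucc ω < 0} from hω)] at h1
      linarith
  have hV0 : ∀ t, ∀ᵐ ω ∂P, V t ω = 0 := by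
    intro t
    induction t using Fin.induction with
    | zero =>
      filter_upwards [hδ0] with ω h
      simp [V, h]
    | succ k ih =>
      have h0 := hNA k (θ k) (hθ k) (by
        filter_upwards [hgain k, ih, hVnn k.succ] with ω h1 h2 h3
        rw [h1, h2, sub_zero]
        exact h3)
      filter_upwards [h0, hgain k, ih] with ω h1 h2 h3
      rw [h2, h3, sub_zero] at h1
      exact h1
  refine (L0_eq_zero_iff ξ).2 ?_
  filter_upwards [hξ, hV0 (Fin.last T), hB0] with ω h1 h2 h3
  rw [h1]
  exact (mul_eq_zero.1 h2).resolve_right (inv_ne_zero (h3 _).ne')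

end

section

/-! ### Martingale measures -/

section

variable {Ω ι : Type*} {G m0 : MeasurableSpace Ω} {μ ν : Measure Ω}

/-- A bounded position in martingale increments has expected gain zero, and an arbitrage can be
rescaled to be bounded. -/
theorem noArbitrageStep_of_condExp_eq_zero [Fintype ι] [IsFiniteMeasure μ] (hG : G ≤ m0)
    {X : ι → Ω → ℝ} (hX : ∀ i, Integrable (X i) μ) (h : ∀ i, μ[X i | G] =ᵐ[μ] 0) :
    NoArbitrageStep G μ X := by
  intro θ hθ h0
  let r : Ω → ℝ := fun ω => 1 + ∑ i, |θ i ω|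
  have hr0 : ∀ ω, 0 < r ω := fun ω =>
    add_pos_of_pos_of_nonneg one_pos (Finset.sum_nonneg fun _ _ => abs_nonneg _)
  have hrm : Measurable[G] r :=
    measurable_const.add (Finset.measurable_fun_sum _ fun i _ => measurable_norm.comp (hθ i))
  have ham : ∀ i, Measurable[G] fun ω => θ i ω / r ω := fun i => (hθ i).div hrm
  have hab : ∀ i ω, |θ i ω / r ω| ≤ 1 := fun i ω => by
    rw [abs_div, abs_of_pos (hr0 ω)]
    refine div_le_one_of_le₀ ?_ (hr0 ω).le
    exact (Finset.single_le_sum (f := fun i => |θ i ω|) (fun _ _ => abs_nonneg _)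
      (Finset.mem_univ i)).trans (le_add_of_nonneg_left zero_le_one)
  have hdiv : ∀ ω, ∑ i, θ i ω / r ω * X i ω = (∑ i, θ i ω * X i ω) / r ω := fun ω => by
    rw [Finset.sum_div]
    exact Finset.sum_congr rfl fun i _ => div_mul_eq_mul_div _ _ _
  have hint : Integrable (fun ω => ∑ i, θ i ω / r ω * X i ω) μ :=
    integrable_finsetSum _ fun i _ => (hX i).bdd_mul
      ((ham i).mono hG le_rfl).aestronglyMeasurable (.of_forall (hab i))
  have hcond := condExp_sum_mul hG Finset.univ ham hab hX
  have hzero : ∫ ω, ∑ i, θ i ω / r ω * X i ω ∂μ = 0 := by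
    rw [← integral_condExp hG]
    refine integral_eq_zero_of_ae ?_
    filter_upwards [hcond, ae_all_iff.2 h] with ω h1 h2
    rw [h1]
    exact Finset.sum_eq_zero fun i _ => by rw [h2 i, Pi.zero_apply, mul_zero]
  rw [integral_eq_zero_iff_of_nonneg_ae (by
    filter_upwards [h0] with ω h1
    rw [hdiv]
    exact div_nonneg h1 (hr0 ω).le) hint] at hzero
  filter_upwards [hzero] with ω h1
  rw [hdiv] at h1
  exact (div_eq_zero_iff.1 h1).resolve_right (hr0 ω).ne'

theorem setIntegral_withDensity_ofReal {f g : Ω → ℝ} (hf : Measurable f) (hf0 : 0 ≤ᵐ[μ] f)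
    {A : Set Ω} (hA : MeasurableSet A) :
    ∫ ω in A, g ω ∂(μ.withDensity fun ω => ENNReal.ofReal (f ω)) = ∫ ω in A, f ω * g ω ∂μ := by
  rw [setIntegral_withDensity_eq_setIntegral_toReal_smul hf.ennreal_ofReal
    (.of_forall fun _ => ENNReal.ofReal_lt_top) _ hA]
  refine setIntegral_congr_ae hA ?_
  filter_upwards [hf0] with ω h _
  rw [ENNReal.toReal_ofReal h, smul_eq_mul]

theorem NoArbitrageStep.of_equivalent [Fintype ι] {X : ι → Ω → ℝ} (h : NoArbitrageStep G ν X)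
    (hνμ : ν ≪ μ) (hμν : μ ≪ ν) : NoArbitrageStep G μ X :=
  fun θ hθ h0 => hμν.ae_le (h θ hθ (hνμ.ae_le h0))

end

variable {Ω ι : Type*} {m : MeasurableSpace Ω} {T : ℕ} {ℱ : Filtration (Fin (T + 1)) m}
  {P : Measure Ω}

theorem IsEMM.noArbitrageStep [Fintype ι] {X : ι → Fin (T + 1) → Ω → ℝ}
    {Q : @Measure Ω (ℱ (Fin.last T))} (hQ : IsEMM ℱ P X Q) (k : Fin T) :
    NoArbitrageStep (ℱ k.castSucc) P fun i ω => X i k.succ ω - X i k.castSucc ω := by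
  have := hQ.isProbabilityMeasure
  have hle : ∀ t, ℱ t ≤ ℱ (Fin.last T) := fun t => ℱ.mono (Fin.le_last t)
  have hXm : ∀ i t, Measurable[ℱ (Fin.last T)] (X i t) := fun i t =>
    ((hQ.martingale i).stronglyMeasurable t).measurable.mono (hle t) le_rfl
  refine (noArbitrageStep_trim_iff (hle _) (ℱ.le _) fun i => (hXm i _).sub (hXm i _)).1 ?_
  refine NoArbitrageStep.of_equivalent (noArbitrageStep_of_condExp_eq_zero (hle _)
    (fun i => ((hQ.martingale i).integrable _).sub ((hQ.martingale i).integrable _)) fun i => ?_)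
    hQ.absolutelyContinuous hQ.absolutelyContinuous'
  have h1 := condExp_sub ((hQ.martingale i).integrable k.succ)
    ((hQ.martingale i).integrable k.castSucc) (ℱ k.castSucc)
  have h2 : Q[X i k.succ | ℱ k.castSucc] =ᵐ[Q] X i k.castSucc :=
    (hQ.martingale i).condExp_ae_eq k.castSucc_lt_succ.le
  have h3 : Q[X i k.castSucc | ℱ k.castSucc] =ᵐ[Q] X i k.castSucc :=
    (hQ.martingale i).condExp_ae_eq le_rfl
  filter_upwards [h1, h2, h3] with ω h4 h5 h6
  refine h4.trans ?_
  rw [Pi.sub_apply, h5, h6, sub_self]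
  rfl

/-- A positive martingale that deflates nonnegative processes to martingales is, up to
normalization, the density process of an equivalent martingale measure. -/
theorem exists_isEMM_of_deflator [IsProbabilityMeasure P] {X : ι → Fin (T + 1) → Ω → ℝ}
    (hX : ∀ i t, Measurable[ℱ t] (X i t)) (hX0 : ∀ i t, 0 ≤ᵐ[P] X i t)
    {D : Fin (T + 1) → Ω → ℝ} (hD : Martingale D ℱ P) (hD0 : ∀ t, ∀ᵐ ω ∂P, 0 < D t ω)
    (hXD : ∀ i, Martingale (fun t ω => X i t ω * D t ω) ℱ P) :
    ∃ Q : @Measure Ω (ℱ (Fin.last T)), IsEMM ℱ P X Q := by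
  have hF : ℱ (Fin.last T) ≤ m := ℱ.le _
  have hle : ∀ t, ℱ t ≤ ℱ (Fin.last T) := fun t => ℱ.mono (Fin.le_last t)
  set L := D (Fin.last T) 
  have hLm : Measurable[ℱ (Fin.last T)] L := (hD.stronglyMeasurable _).measurable
  have hLi : Integrable L P := hD.integrable _
  have hL0 : 0 ≤ᵐ[P] L := by
    filter_upwards [hD0 (Fin.last T)] with ω h using h.le
  set c := ∫ ω, L ω ∂P
  have hc : 0 < c := by
    rw [integral_pos_iff_support_of_nonneg_ae hL0 hLi, pos_iff_ne_zero]
    intro h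
    have h1 : ∀ᵐ ω ∂P, False := by
      filter_upwards [measure_eq_zero_iff_ae_notMem.1 h, hD0 (Fin.last T)] with ω h2 h3
      exact h2 h3.ne'
    exact IsProbabilityMeasure.ne_zero P (by simpa using h1)
  -- deflating by the terminal density or by the current one gives the same set integrals
  have hXL : ∀ i t, Integrable (fun ω => X i t ω * L ω) P ∧
      P[fun ω => X i t ω * L ω | ℱ t] =ᵐ[P] fun ω => X i t ω * D t ω := by
    intro i t
    have h1 : P[L | ℱ t] =ᵐ[P] D t := hD.condExp_ae_eq (Fin.le_last t)
    have h2 : (fun ω => X i t ω * P[L | ℱ t] ω) =ᵐ[P] fun ω => X i t ω * D t ω := by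
      filter_upwards [h1] with ω h
      rw [h]
    have h3 := ((hXD i).integrable t).congr h2.symm
    exact ⟨integrable_mul_of_integrable_mul_condExp (ℱ.le t) (hX i t) (hX0 i t) hLi hL0 h3,
      (condExp_mul_of_nonneg (ℱ.le t) (hX i t) (hX0 i t) hLi hL0 h3).trans h2⟩
  let ρ : Ω → ℝ≥0∞ := fun ω => ENNReal.ofReal (L ω / c)
  have hρm : Measurable[ℱ (Fin.last T)] ρ := (hLm.div_const c).ennreal_ofReal
  let Q : @Measure Ω (ℱ (Fin.last T)) := (terminalMeasure ℱ P).withDensity ρ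
  have hQP : Q ≪ terminalMeasure ℱ P := withDensity_absolutelyContinuous _ _
  have hL0' : ∀ᵐ ω ∂(terminalMeasure ℱ P), 0 < L ω :=
    ae_trim_of_ae hF (measurableSet_lt measurable_const hLm) (hD0 _)
  have hPQ : terminalMeasure ℱ P ≪ Q := by
    refine withDensity_absolutelyContinuous' hρm.aemeasurable ?_
    filter_upwards [hL0'] with ω h
    exact (ENNReal.ofReal_pos.2 (div_pos h hc)).ne'
  have hQ1 : IsProbabilityMeasure Q := by
    refine ⟨?_⟩
    rw [withDensity_apply _ MeasurableSet.univ, setLIntegral_univ, lintegral_trim hF hρm,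
      ← ofReal_integral_eq_lintegral_ofReal (hLi.div_const c), integral_div, div_self hc.ne',
      ENNReal.ofReal_one]
    filter_upwards [hL0] with ω h using div_nonneg h hc.le
  have hρtop : ∀ᵐ ω ∂(terminalMeasure ℱ P), ρ ω < ∞ := .of_forall fun _ => ENNReal.ofReal_lt_top
  have hρreal : ∀ᵐ ω ∂(terminalMeasure ℱ P), (ρ ω).toReal = L ω / c := by
    filter_upwards [hL0'] with ω h
    exact ENNReal.toReal_ofReal (div_pos h hc).le
  have hXlast : ∀ i t, Measurable[ℱ (Fin.last T)] (X i t) := fun i t => (hX i t).mono (hle t) le_rfl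
  have hint : ∀ i t, Integrable (X i t) Q := by
    intro i t
    rw [integrable_withDensity_iff_integrable_smul' hρm hρtop]
    have h1 : Integrable (fun ω => X i t ω * L ω / c) (terminalMeasure ℱ P) :=
      ((hXL i t).1.div_const c).trim hF (((hXlast i t).mul hLm).div_const c).stronglyMeasurable
    refine h1.congr ?_
    filter_upwards [hρreal] with ω h
    rw [h, smul_eq_mul]
    ring
  have hset : ∀ i t A, MeasurableSet[ℱ t] A →
      ∫ ω in A, X i t ω ∂Q = (∫ ω in A, X i t ω * D t ω ∂P) / c := by
    intro i t A hA
    have h0 : 0 ≤ᵐ[terminalMeasure ℱ P] fun ω => L ω / c := by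
      filter_upwards [hL0'] with ω h using (div_pos h hc).le
    have h1 : ∫ ω in A, X i t ω ∂Q = ∫ ω in A, L ω / c * X i t ω ∂(terminalMeasure ℱ P) :=
      setIntegral_withDensity_ofReal (hLm.div_const c) h0 (hle t A hA)
    have h2 : ∀ ω, L ω / c * X i t ω = X i t ω * L ω / c := fun ω => by ring
    have h3 : ∫ ω in A, L ω / c * X i t ω ∂(terminalMeasure ℱ P) =
        ∫ ω in A, L ω / c * X i t ω ∂P :=
      (setIntegral_trim hF ((hLm.div_const c).mul (hXlast i t)).stronglyMeasurable
        (hle t A hA)).symm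
    rw [h1, h3]
    simp only [h2]
    rw [integral_div, ← setIntegral_condExp (ℱ.le t) (hXL i t).1 hA]
    congr 1
    refine setIntegral_congr_ae (ℱ.le t A hA) ?_
    filter_upwards [(hXL i t).2] with ω h _ using h
  refine ⟨Q, hQ1, hQP, hPQ, fun i => ⟨fun t => (hX i t).stronglyMeasurable, fun s t hst => ?_⟩⟩
  refine (ae_eq_condExp_of_forall_setIntegral_eq (hle s) (hint i t)
    (fun _ _ _ => (hint i s).integrableOn) (fun A hA _ => ?_)
    (hX i s).stronglyMeasurable.aestronglyMeasurable).symm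
  rw [hset i s A hA, hset i t A (ℱ.mono hst A hA), (hXD i).setIntegral_eq hst hA]

/-! ### The fundamental theorem of asset pricing -/

/-- A random variable that is measurable for a trivial σ-algebra is almost surely constant. -/
theorem integrable_of_measurable_trivial [IsProbabilityMeasure P] {G : MeasurableSpace Ω}
    (hG : G ≤ m) (htriv : ∀ A, MeasurableSet[G] A → P A = 0 ∨ P A = 1) {f : Ω → ℝ}
    (hf : Measurable[G] f) : Integrable f P := by
  obtain ⟨a, ha⟩ := Filter.exists_eventuallyEq_const_of_forall_separating (l := ae P) (f := f)
    MeasurableSet fun U hU => by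
      rcases htriv _ (hf hU) with h | h
      · exact .inr (measure_eq_zero_iff_ae_notMem.1 h)
      · exact .inl ((prob_compl_eq_zero_iff (hG _ (hf hU))).2 h)
  exact (integrable_const a).congr ha.symm

end

end DiscreteMarket

theorem mainTheorem6 {Ω : Type*} {m : MeasurableSpace Ω} (P : Measure Ω) [IsProbabilityMeasure P]
    (T d : ℕ) (ℱ : Filtration (Fin (T + 1)) m)
    (hℱ : ∀ A : Set Ω, MeasurableSet[ℱ 0] A → P A = 0 ∨ P A = 1)
    (S : Fin d → Fin (T + 1) → Ω → ℝ)
    (hS_adapted : ∀ i, Adapted ℱ (S i))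
    (hS_nonneg : ∀ i t, ∀ᵐ ω ∂P, 0 ≤ S i t ω)
    (B : Fin (T + 1) → Ω → ℝ) (hB : DiscreteMarket.IsSavingsAccount ℱ P B) :
    List.TFAE [
      DiscreteMarket.NA (DiscreteMarket.sfOutcomes ℱ P (DiscreteMarket.adjoin S B) 0),
      ∃ D : Fin (T + 1) → Ω → ℝ, Martingale D ℱ P ∧ (∀ t, ∀ᵐ ω ∂P, 0 < D t ω) ∧
        DiscreteMarket.IsEMD ℱ P S (fun t ω => D t ω * (B t ω)⁻¹),
      ∃ Q : @Measure Ω (ℱ (Fin.last T)),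
        DiscreteMarket.IsEMM ℱ P (DiscreteMarket.mulMarket S (fun t ω => (B t ω)⁻¹)) Q] := by
  set X := DiscreteMarket.mulMarket S (fun t ω => (B t ω)⁻¹) with hXdef
  have hX : ∀ i t, Measurable[ℱ t] (X i t) :=
    DiscreteMarket.measurable_mulMarket_inv hS_adapted hB
  have hX0 : ∀ i t, 0 ≤ᵐ[P] X i t := fun i t => by
    filter_upwards [hS_nonneg i t, hB.pos t] with ω h1 h2
    exact mul_nonneg h1 (inv_pos.2 h2).le
  have hcomm : ∀ (D : Fin (T + 1) → Ω → ℝ) i, (fun t ω => S i t ω * (D t ω * (B t ω)⁻¹)) =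
      fun t ω => X i t ω * D t ω := fun D i => by
    ext t ω
    simp only [hXdef, DiscreteMarket.mulMarket]
    ring
  tfae_have 1 → 2 := by
    intro h
    obtain ⟨D, hD, hD0, hXD⟩ := DiscreteMarket.exists_martingale_deflator hX hX0
      (fun i => DiscreteMarket.integrable_of_measurable_trivial (ℱ.le 0) hℱ (hX i 0))
      (h.noArbitrageStep hS_adapted hB)
    refine ⟨D, hD, hD0, ⟨fun t => ?_, fun t => ?_, fun i => ?_⟩⟩
    · exact (hD.stronglyMeasurable t).measurable.mul (hB.measurable t).inv
    · filter_upwards [hD0 t, hB.pos t] with ω h1 h2 using mul_pos h1 (inv_pos.2 h2)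
    · rw [hcomm]
      exact hXD i
  tfae_have 2 → 3 := by
    rintro ⟨D, hD, hD0, hZ⟩
    exact DiscreteMarket.exists_isEMM_of_deflator hX hX0 hD hD0 fun i => hcomm D i ▸ hZ.martingale i
  tfae_have 3 → 1 := by
    rintro ⟨Q, hQ⟩
    exact DiscreteMarket.NA_of_noArbitrageStep hS_adapted hB hQ.noArbitrageStep
  tfae_finish
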